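/- Let $M$ be a filtered manifold: a smooth manifold with a filtration $TM=T^{-k}M\supset\dots\supset T^{-1}M\supset T^0M=0$ of its tangent bundle by smooth subbundles such that $[\Gamma(T^{-i}M),\Gamma(T^{-j}M)]\subset\Gamma(T^{-i-j}M)$ (with $T^{-i}M=TM$ for $i\ge k$). Put $\mathrm{gr}_{-i}(TM)=T^{-i}M/T^{-i+1}M$ and assume that for every $x\in M$ the graded Lie algebra $\mathrm{gr}(T_xM)=\bigoplus_i\mathrm{gr}_{-i}(T_xM)$, with the bracket induced by the Lie bracket of vector fields, is generated by $\mathrm{gr}_{-1}(T_xM)$. Let $E\to M$ be a smooth real vector bundle of constant finite rank. For a vector bundle $V\to M$ and $r\ge 0$ let $J^r(V)$ be the bundle of weighted $r$-jets: two germs $s,s'$ of sections of $V$ at $x$ have the same jet $j^r_xs=j^r_xs'$ iff $D(\langle\lambda,s-s'\rangle)(x)=0$ for all local sections $\lambda$ of $V^*$ and all linear differential operators $D$ on functions of weighted order $\le r$, i.e. locally finite sums of terms $a\,\xi_1\cdots\xi_\ell$ with $a$ a smooth function and $\xi_j\in\Gamma(T^{-w_j}M)$, $w_j\ge1$, $w_1+\dots+w_\ell\le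 r$. Let $\pi^r_s:J^r(V)\to J^s(V)$ ($s\le r$) be the projections and $j^r:\Gamma(V)\to\Gamma(J^r(V))$ the map $s\mapsto(x\mapsto j^r_xs)$. A differential operator of weighted order one from $V$ to $W$ is regarded as a smooth vector bundle map $S:J^1(V)\to W$; its symbol is the restriction of $S$ to $\ker\pi^1_0\cong\mathrm{gr}_{-1}(TM)^*\otimes V$, where $df|_{\mathrm{gr}_{-1}(T_xM)}\otimes\sigma(x)$ corresponds to $j^1_x(f\sigma)$ for $f(x)=0$. Regard $J^{r+1}(E)$ as a subset of $J^1(J^r(E))$ through $j^{r+1}_xs\mapsto j^1_x(j^rs)$. Let $r\ge1$. Then there exists a unique differential operator of weighted order one $$S:J^1(J^r(E))\to\mathrm{gr}_{-1}(TM)^*\otimes J^{r-1}(E)$$ such that $J^{r+1}(E)\subseteq\ker S$ and the symbol of $S$ is $$\mathrm{id}\otimes\pi^r_{r-1}:\mathrm{gr}_{-1}(TM)^*\otimes J^r(E)\to\mathrm{gr}_{-1}(TM)^*\otimes J^{r-1}(E).$$ Moreover, the sequence of sheaves $$0\to\Gamma(E)\xrightarrow{\ j^r\ }\Gamma(J^r(E))\xrightarrow{\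 S\circ j^1\ }\Gamma(\mathrm{gr}_{-1}(TM)^*\otimes J^{r-1}(E))$$ is exact: over every open $U\subseteq M$ the map $j^r$ is injective, and a section $\sigma$ of $J^r(E)$ over $U$ satisfies $S(j^1\sigma)=0$ if and only if $\sigma=j^rs$ for some section $s$ of $E$ over $U$. -/

import Mathlib

open scoped Manifold ContDiff Topology TensorProduct
open Bundle Filter TopologicalSpace

namespace WeightedJet

universe u v w

noncomputable section

section Functions

variable {n : ℕ} {M : Type u} [TopologicalSpace M] [ChartedSpace (EuclideanSpace ℝ (Fin n)) M]

/-- The real function `f` is smooth on some neighbourhood of `x`. A function that is only defined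
near `x` is represented by an arbitrary extension to `M`; the same convention is used below for
local sections and local vector fields. -/
def SmoothNear (n : ℕ) {M : Type u} [TopologicalSpace M]
    [ChartedSpace (EuclideanSpace ℝ (Fin n)) M] (x : M) (f : M → ℝ) : Prop :=
  ∀ᶠ y in 𝓝 x, ContMDiffAt (𝓡 n) 𝓘(ℝ, ℝ) ∞ f y

/-- The vector field `X` is smooth on some neighbourhood of `x`. -/
def VFSmoothNear [IsManifold (𝓡 n) ∞ M] (x : M) (X : ∀ y : M, TangentSpace (𝓡 n) y) : Prop :=
  ∀ᶠ y in 𝓝 x, ContMDiffAt (𝓡 n) (𝓡 n).tangent ∞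
    (fun z => (TotalSpace.mk' (EuclideanSpace ℝ (Fin n)) z (X z) : TangentBundle (𝓡 n) M)) y

/-- The derivative `X · f` of a function along a vector field. -/
def lieD (X : ∀ y : M, TangentSpace (𝓡 n) y) (f : M → ℝ) : M → ℝ :=
  fun y => mvfderiv (𝓡 n) f y (X y)

/-- Iterated derivative `X₁ · X₂ ⋯ Xₛ · f` along a list of vector fields. -/
def iterD : List (∀ y : M, TangentSpace (𝓡 n) y) → (M → ℝ) → M → ℝ
  | [], f => f
  | X :: L, f => lieD X (iterD L f)

theorem SmoothNear.at {x : M} {f : M → ℝ} (h : SmoothNear n x f) :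
    ContMDiffAt (𝓡 n) 𝓘(ℝ, ℝ) ∞ f x := h.self_of_nhds

theorem SmoothNear.mdiff {x : M} {f : M → ℝ} (h : SmoothNear n x f) :
    MDifferentiableAt (𝓡 n) 𝓘(ℝ, ℝ) f x := h.at.mdifferentiableAt (by simp)

theorem SmoothNear.eventually {x : M} {f : M → ℝ} (h : SmoothNear n x f) :
    ∀ᶠ y in 𝓝 x, SmoothNear n y f := eventually_eventually_nhds.2 h

theorem SmoothNear.congr {x : M} {f g : M → ℝ} (h : SmoothNear n x f)
    (hfg : ∀ᶠ y in 𝓝 x, f y = g y) : SmoothNear n x g := by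
  filter_upwards [h, eventually_eventually_nhds.2 hfg] with y hy hy'
  exact hy.congr_of_eventuallyEq (hy'.mono fun z hz => hz.symm)

theorem SmoothNear.const (x : M) (c : ℝ) : SmoothNear n x (fun _ => c) :=
  Eventually.of_forall fun _ => contMDiffAt_const

theorem SmoothNear.add {x : M} {f g : M → ℝ} (hf : SmoothNear n x f) (hg : SmoothNear n x g) :
    SmoothNear n x (fun y => f y + g y) := by
  filter_upwards [hf, hg] with y h1 h2 using h1.add h2

theorem SmoothNear.mul {x : M} {f g : M → ℝ} (hf : SmoothNear n x f) (hg : SmoothNear n x g) :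
    SmoothNear n x (fun y => f y * g y) := by
  filter_upwards [hf, hg] with y h1 h2 using h1.mul h2

theorem SmoothNear.sum {x : M} {ι : Type*} (s : Finset ι) {f : ι → M → ℝ}
    (hf : ∀ i ∈ s, SmoothNear n x (f i)) : SmoothNear n x (fun y => ∑ i ∈ s, f i y) := by
  classical
  induction s using Finset.induction_on with
  | empty => simpa using SmoothNear.const x 0
  | insert a s ha ih =>
    simp only [Finset.sum_insert ha]
    exact (hf a (by simp)).add (ih fun i hi => hf i (by simp [hi]))

theorem lieD_congr {x : M} {f g : M → ℝ} (X : ∀ y : M, TangentSpace (𝓡 n) y)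
    (h : ∀ᶠ y in 𝓝 x, f y = g y) : ∀ᶠ y in 𝓝 x, lieD X f y = lieD X g y := by
  filter_upwards [eventually_eventually_nhds.2 h] with y hy
  have h1 : mfderiv (𝓡 n) 𝓘(ℝ, ℝ) f y = mfderiv (𝓡 n) 𝓘(ℝ, ℝ) g y :=
    Filter.EventuallyEq.mfderiv_eq hy
  change (mfderiv (𝓡 n) 𝓘(ℝ, ℝ) f y (X y) : ℝ) = mfderiv (𝓡 n) 𝓘(ℝ, ℝ) g y (X y)
  rw [h1]
  rfl

theorem iterD_congr {x : M} {f g : M → ℝ} (L : List (∀ y : M, TangentSpace (𝓡 n) y))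
    (h : ∀ᶠ y in 𝓝 x, f y = g y) : ∀ᶠ y in 𝓝 x, iterD L f y = iterD L g y := by
  induction L with
  | nil => exact h
  | cons X L ih => exact lieD_congr X ih

theorem lieD_add {x : M} {f g : M → ℝ} (X : ∀ y : M, TangentSpace (𝓡 n) y)
    (hf : SmoothNear n x f) (hg : SmoothNear n x g) :
    lieD X (fun y => f y + g y) x = lieD X f x + lieD X g x := by
  simp only [lieD]
  rw [mvfderiv_fun_add hf.mdiff hg.mdiff]
  rfl

theorem lieD_mul {x : M} {f g : M → ℝ} (X : ∀ y : M, TangentSpace (𝓡 n) y)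
    (hf : SmoothNear n x f) (hg : SmoothNear n x g) :
    lieD X (fun y => f y * g y) x = f x * lieD X g x + g x * lieD X f x := by
  simp only [lieD]
  rw [mvfderiv_fun_mul hf.mdiff hg.mdiff]
  rfl

theorem lieD_const {x : M} (X : ∀ y : M, TangentSpace (𝓡 n) y) (c : ℝ) :
    lieD X (fun _ => c) x = 0 := by
  simp only [lieD]
  rw [mvfderiv_const]
  rfl

variable [IsManifold (𝓡 n) ∞ M]

theorem VFSmoothNear.eventually {x : M} {X : ∀ y : M, TangentSpace (𝓡 n) y}
    (h : VFSmoothNear x X) : ∀ᶠ y in 𝓝 x, VFSmoothNear y X := eventually_eventually_nhds.2 h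

theorem SmoothNear.lieD {x : M} {f : M → ℝ} {X : ∀ y : M, TangentSpace (𝓡 n) y}
    (hf : SmoothNear n x f) (hX : VFSmoothNear x X) : SmoothNear n x (lieD X f) := by
  filter_upwards [hf, hX] with y h1 h2
  have h3 := h1.mfderiv_const (m := ∞) (by simp)
  have h4 := ContMDiffAt.clm_apply_of_inCoordinates
    (F₁ := EuclideanSpace ℝ (Fin n)) (F₂ := ℝ)
    (E₁ := fun z : M => TangentSpace (𝓡 n) z) (E₂ := fun z : ℝ => TangentSpace 𝓘(ℝ, ℝ) z)
    (b₁ := fun z : M => z) (b₂ := f) (ϕ := fun z => mfderiv (𝓡 n) 𝓘(ℝ, ℝ) f z) (v := X)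
    h3 h2 h1
  exact (contMDiff_snd_tangentBundle_modelSpace ℝ 𝓘(ℝ, ℝ)).contMDiffAt.comp y h4

theorem SmoothNear.iterD {x : M} {f : M → ℝ} {L : List (∀ y : M, TangentSpace (𝓡 n) y)}
    (hf : SmoothNear n x f) (hL : ∀ X ∈ L, VFSmoothNear x X) : SmoothNear n x (iterD L f) := by
  induction L with
  | nil => exact hf
  | cons X L ih => exact (ih fun Y hY => hL Y (by simp [hY])).lieD (hL X (by simp))

theorem iterD_add {x : M} {f g : M → ℝ} (L : List (∀ y : M, TangentSpace (𝓡 n) y))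
    (hL : ∀ X ∈ L, VFSmoothNear x X) (hf : SmoothNear n x f) (hg : SmoothNear n x g) :
    ∀ᶠ y in 𝓝 x, iterD L (fun z => f z + g z) y = iterD L f y + iterD L g y := by
  induction L with
  | nil => exact Eventually.of_forall fun _ => rfl
  | cons X L ih =>
    have hL' : ∀ Y ∈ L, VFSmoothNear x Y := fun Y hY => hL Y (by simp [hY])
    filter_upwards [lieD_congr X (ih hL'), (hf.iterD hL').eventually, (hg.iterD hL').eventually]
      with y h1 h2 h3
    exact h1.trans (lieD_add X h2 h3)

theorem iterD_smul {x : M} {f : M → ℝ} (c : ℝ) (L : List (∀ y : M, TangentSpace (𝓡 n) y))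
    (hL : ∀ X ∈ L, VFSmoothNear x X) (hf : SmoothNear n x f) :
    ∀ᶠ y in 𝓝 x, iterD L (fun z => c * f z) y = c * iterD L f y := by
  induction L with
  | nil => exact Eventually.of_forall fun _ => rfl
  | cons X L ih =>
    have hL' : ∀ Y ∈ L, VFSmoothNear x Y := fun Y hY => hL Y (by simp [hY])
    filter_upwards [lieD_congr X (ih hL'), (hf.iterD hL').eventually] with y h1 h2
    refine h1.trans ((lieD_mul X (SmoothNear.const y c) h2).trans ?_)
    rw [lieD_const]
    simp [iterD]

end Functions

/-! ### Vector bundles and their smooth sections -/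

/-- A bundle over `M`, described by its fibres (real vector spaces) and its sheaf of smooth
sections: `germs x` consists of the sections that are smooth on some neighbourhood of `x`. A smooth
vector bundle is determined by these data, and all bundles used below are given by them. -/
structure SmoothBundle (n : ℕ) (M : Type u) [TopologicalSpace M]
    [ChartedSpace (EuclideanSpace ℝ (Fin n)) M] where
  Fiber : M → Type v
  [addCommGroup : ∀ x, AddCommGroup (Fiber x)]
  [module : ∀ x, Module ℝ (Fiber x)]
  germs : ∀ _ : M, Submodule ℝ (∀ y, Fiber y)
  congr' : ∀ {x : M} {σ τ : ∀ y, Fiber y}, σ ∈ germs x → (∀ᶠ y in 𝓝 x, σ y = τ y) → τ ∈ germs x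
  eventually' : ∀ {x : M} {σ : ∀ y, Fiber y}, σ ∈ germs x → ∀ᶠ y in 𝓝 x, σ ∈ germs y
  smul' : ∀ {x : M} {f : M → ℝ} {σ : ∀ y, Fiber y}, SmoothNear n x f → σ ∈ germs x →
    (fun y => f y • σ y) ∈ germs x

attribute [instance] SmoothBundle.addCommGroup SmoothBundle.module

section Bundles

variable {n : ℕ} {M : Type u} [TopologicalSpace M] [ChartedSpace (EuclideanSpace ℝ (Fin n)) M]

/-- A smooth vector bundle in the sense of Mathlib, with its usual smooth sections. -/
abbrev ofVectorBundle (n : ℕ) {M : Type u} [TopologicalSpace M]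
    [ChartedSpace (EuclideanSpace ℝ (Fin n)) M]
    (F : Type w) [NormedAddCommGroup F] [NormedSpace ℝ F]
    (E : M → Type v) [TopologicalSpace (TotalSpace F E)] [∀ x, TopologicalSpace (E x)]
    [∀ x, AddCommGroup (E x)] [∀ x, Module ℝ (E x)] [FiberBundle F E] [VectorBundle ℝ F E]
    [ContMDiffVectorBundle ∞ F E (𝓡 n)] : SmoothBundle.{u, v} n M where
  Fiber := E
  germs x :=
    { carrier := {σ | ∀ᶠ y in 𝓝 x, ContMDiffAt (𝓡 n) ((𝓡 n).prod 𝓘(ℝ, F)) ∞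
        (fun z => TotalSpace.mk' F z (σ z)) y}
      add_mem' := fun {a b} ha hb => by
        filter_upwards [ha, hb] with y h1 h2 using h1.add_section h2
      zero_mem' := Eventually.of_forall fun y =>
        (contMDiff_zeroSection (IB := 𝓡 n) (n := ∞) ℝ (F := F) E).contMDiffAt
      smul_mem' := fun c a ha => by
        filter_upwards [ha] with y h1 using h1.const_smul_section }
  congr' := fun {x σ τ} h hst => by
    filter_upwards [h, eventually_eventually_nhds.2 hst] with y hy hy'
    exact hy.congr_of_eventuallyEq (hy'.mono fun z hz => by simp [hz])
  eventually' := fun h => eventually_eventually_nhds.2 h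
  smul' := fun {x f σ} hf h => by
    filter_upwards [h, hf] with y h1 h2 using h2.smul_section h1

/-- The bundle with given fibres whose smooth sections are locally the finite sums `∑ fᵢ gᵢ` with
smooth functions `fᵢ` and `gᵢ` in a given collection `gen x` of local sections around `x`. -/
abbrev generatedBy (Fib : M → Type v) [∀ x, AddCommGroup (Fib x)] [∀ x, Module ℝ (Fib x)]
    (gen : M → Set (∀ y, Fib y))
    (hgen : ∀ x, ∀ g ∈ gen x, ∀ᶠ y in 𝓝 x, g ∈ gen y) : SmoothBundle.{u, v} n M where
  Fiber := Fib
  germs x :=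
    { carrier := {σ | ∃ (m : ℕ) (f : Fin m → M → ℝ) (g : Fin m → ∀ y, Fib y),
        (∀ i, SmoothNear n x (f i)) ∧ (∀ i, g i ∈ gen x) ∧
        ∀ᶠ y in 𝓝 x, σ y = ∑ i, f i y • g i y}
      add_mem' := by
        rintro a b ⟨m, f, g, hf, hg, h⟩ ⟨m', f', g', hf', hg', h'⟩
        refine ⟨m + m', Fin.append f f', Fin.append g g', ?_, ?_, ?_⟩
        · exact fun i => Fin.addCases (by simpa using hf) (by simpa using hf') i
        · exact fun i => Fin.addCases (by simpa using hg) (by simpa using hg') i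
        · filter_upwards [h, h'] with y h1 h2
          simp [Fin.sum_univ_add, h1, h2]
      zero_mem' := ⟨0, fun i => i.elim0, fun i => i.elim0, fun i => i.elim0, fun i => i.elim0,
        by simp⟩
      smul_mem' := by
        rintro c a ⟨m, f, g, hf, hg, h⟩
        refine ⟨m, fun i y => c * f i y, g, fun i => (SmoothNear.const x c).mul (hf i), hg, ?_⟩
        filter_upwards [h] with y h1
        simp [h1, Finset.smul_sum, mul_smul] }
  congr' := by
    rintro x σ τ ⟨m, f, g, hf, hg, h⟩ hst
    refine ⟨m, f, g, hf, hg, ?_⟩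
    filter_upwards [h, hst] with y h1 h2 using h2.symm.trans h1
  eventually' := by
    rintro x σ ⟨m, f, g, hf, hg, h⟩
    filter_upwards [eventually_all.2 fun i => (hf i).eventually,
      eventually_all.2 fun i => hgen x _ (hg i), eventually_eventually_nhds.2 h] with y h1 h2 h3
    exact ⟨m, f, g, h1, h2, h3⟩
  smul' := by
    rintro x a σ ha ⟨m, f, g, hf, hg, h⟩
    refine ⟨m, fun i y => a y * f i y, g, fun i => ha.mul (hf i), hg, ?_⟩
    filter_upwards [h] with y h1
    simp [h1, Finset.smul_sum, mul_smul]

namespace SmoothBundle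

/-- The dual bundle: a family of linear forms is smooth near `x` if its values on the smooth local
sections around the points near `x` are smooth functions. -/
abbrev dual (V : SmoothBundle.{u, v} n M) : SmoothBundle.{u, v} n M where
  Fiber x := Module.Dual ℝ (V.Fiber x)
  germs x :=
    { carrier := {φ : ∀ y, Module.Dual ℝ (V.Fiber y) | ∀ᶠ y in 𝓝 x, ∀ σ ∈ V.germs y, SmoothNear n y (fun z => φ z (σ z))}
      add_mem' := fun {a b} ha hb => by
        filter_upwards [ha, hb] with y h1 h2 σ hσ using (h1 σ hσ).add (h2 σ hσ)
      zero_mem' := Eventually.of_forall fun y σ _ => SmoothNear.const y 0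
      smul_mem' := fun c a ha => by
        filter_upwards [ha] with y h1 σ hσ using (SmoothNear.const y c).mul (h1 σ hσ) }
  congr' := fun {x a b} ha hab => by
    filter_upwards [ha, eventually_eventually_nhds.2 hab] with y h1 h2 σ hσ
    exact (h1 σ hσ).congr (h2.mono fun z hz => by rw [hz])
  eventually' := fun h => eventually_eventually_nhds.2 h
  smul' := fun {x f a} hf ha => by
    filter_upwards [ha, hf.eventually] with y h1 h2 σ hσ using h2.mul (h1 σ hσ)

/-- The tensor product of two bundles; its smooth sections are locally finite sums of products
`φ ⊗ σ` of smooth sections. -/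
abbrev tensor (V : SmoothBundle.{u, v} n M) (W : SmoothBundle.{u, w} n M) :
    SmoothBundle.{u, max v w} n M :=
  generatedBy (fun x => V.Fiber x ⊗[ℝ] W.Fiber x)
    (fun x => {τ | ∃ φ ∈ V.germs x, ∃ σ ∈ W.germs x, τ = fun y => φ y ⊗ₜ[ℝ] σ y})
    (by
      rintro x _ ⟨φ, hφ, σ, hσ, rfl⟩
      filter_upwards [V.eventually' hφ, W.eventually' hσ] with y h1 h2
      exact ⟨φ, h1, σ, h2, rfl⟩)

/-- A (smooth) vector bundle map over the identity of `M`. -/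
@[ext]
structure Hom (V : SmoothBundle.{u, v} n M) (W : SmoothBundle.{u, w} n M) where
  app : ∀ x, V.Fiber x →ₗ[ℝ] W.Fiber x
  smooth : ∀ (x : M) (σ : ∀ y, V.Fiber y), σ ∈ V.germs x → (fun y => app y (σ y)) ∈ W.germs x

/-- Every vector is the value of a local smooth section (true for every vector bundle). -/
def Spanned (V : SmoothBundle.{u, v} n M) : Prop :=
  ∀ (x : M) (v : V.Fiber x), ∃ σ ∈ V.germs x, σ x = v

/-- Evaluation of local sections at `x`. -/
def evalAt (V : SmoothBundle.{u, v} n M) (x : M) : V.germs x →ₗ[ℝ] V.Fiber x :=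
  (LinearMap.proj x) ∘ₗ (V.germs x).subtype

theorem evalAt_surjective {V : SmoothBundle.{u, v} n M} (hV : V.Spanned) (x : M) :
    Function.Surjective (V.evalAt x) := by
  intro v
  obtain ⟨σ, hσ, h⟩ := hV x v
  exact ⟨⟨σ, hσ⟩, h⟩

theorem pairing_smooth {V : SmoothBundle.{u, v} n M} {x : M} {φ : ∀ y, Module.Dual ℝ (V.Fiber y)}
    (hφ : φ ∈ V.dual.germs x) {σ : ∀ y, V.Fiber y} (hσ : σ ∈ V.germs x) :
    SmoothNear n x (fun y => φ y (σ y)) :=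
  Eventually.self_of_nhds
    (p := fun y => ∀ σ ∈ V.germs y, SmoothNear n y (fun z => φ z (σ z))) hφ σ hσ

open scoped Classical in
/-- Extension by zero of a section over the open set `U`. -/
def extend (V : SmoothBundle.{u, v} n M) {U : Opens M} (σ : ∀ x : U, V.Fiber x) :
    ∀ x, V.Fiber x :=
  fun x => if h : x ∈ U then σ ⟨x, h⟩ else 0

theorem extend_apply (V : SmoothBundle.{u, v} n M) {U : Opens M} (σ : ∀ x : U, V.Fiber x)
    {x : M} (h : x ∈ U) : V.extend σ x = σ ⟨x, h⟩ := by
  simp [extend, h]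

theorem extend_add (V : SmoothBundle.{u, v} n M) {U : Opens M} (σ τ : ∀ x : U, V.Fiber x) :
    V.extend (σ + τ) = V.extend σ + V.extend τ := by
  funext x
  by_cases h : x ∈ U <;> simp [extend, h]

theorem extend_smul (V : SmoothBundle.{u, v} n M) {U : Opens M} (c : ℝ)
    (σ : ∀ x : U, V.Fiber x) : V.extend (c • σ) = c • V.extend σ := by
  funext x
  by_cases h : x ∈ U <;> simp [extend, h]

theorem extend_zero (V : SmoothBundle.{u, v} n M) {U : Opens M} :
    V.extend (0 : ∀ x : U, V.Fiber x) = 0 := by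
  funext x
  by_cases h : x ∈ U <;> simp [extend, h]

/-- The space `Γ(U, V)` of smooth sections of `V` over the open set `U`. -/
def sections (V : SmoothBundle.{u, v} n M) (U : Opens M) : Submodule ℝ (∀ x : U, V.Fiber x) where
  carrier := {σ | ∀ x ∈ U, V.extend σ ∈ V.germs x}
  add_mem' := fun {a b} ha hb x hx => by
    rw [extend_add]
    exact add_mem (ha x hx) (hb x hx)
  zero_mem' := fun x _ => by
    rw [extend_zero]
    exact zero_mem _
  smul_mem' := fun c a ha x hx => by
    rw [extend_smul]
    exact Submodule.smul_mem _ c (ha x hx)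

/-- The map `Γ(U, V) → Γ(U, W)` induced by a bundle map. -/
def Hom.onSections {V : SmoothBundle.{u, v} n M} {W : SmoothBundle.{u, w} n M} (S : Hom V W)
    (U : Opens M) : V.sections U →ₗ[ℝ] W.sections U where
  toFun σ := ⟨fun x => S.app x (σ.1 x), fun x hx => by
    refine W.congr' (S.smooth x _ (σ.2 x hx)) ?_
    filter_upwards [U.isOpen.mem_nhds hx] with y hy
    rw [extend_apply _ _ hy, extend_apply _ _ hy]⟩
  map_add' σ τ := by
    ext x
    simp
  map_smul' c σ := by
    ext x
    simp

end SmoothBundle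

end Bundles

/-! ### Filtered manifolds -/

/-- A filtration `TM = T⁻ᵏM ⊇ ⋯ ⊇ T⁻¹M ⊇ T⁰M = 0` of the tangent bundle by smooth subbundles which is
compatible with the Lie bracket of vector fields. Here `T i x` is the fibre of `T⁻ⁱM` at `x`. -/
structure FilteredManifold (n : ℕ) (M : Type u) [TopologicalSpace M]
    [ChartedSpace (EuclideanSpace ℝ (Fin n)) M] [IsManifold (𝓡 n) ∞ M] where
  depth : ℕ
  T : ℕ → ∀ x : M, Submodule ℝ (TangentSpace (𝓡 n) x)
  mono : ∀ (x : M) {i j : ℕ}, i ≤ j → T i x ≤ T j x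
  zero : ∀ x, T 0 x = ⊥
  top : ∀ x, ∀ i ≥ depth, T i x = ⊤
  /-- Each `T⁻ⁱM` is a smooth subbundle: around every point it has a smooth local frame. -/
  subbundle : ∀ (i : ℕ) (x : M), ∃ (m : ℕ) (X : Fin m → ∀ y : M, TangentSpace (𝓡 n) y),
    (∀ a, VFSmoothNear x (X a)) ∧
    ∀ᶠ y in 𝓝 x, LinearIndependent ℝ (fun a => X a y) ∧
      Submodule.span ℝ (Set.range fun a => X a y) = T i y
  bracket : ∀ (i j : ℕ) (x : M) (X Y : ∀ y : M, TangentSpace (𝓡 n) y),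
    VFSmoothNear x X → (∀ᶠ y in 𝓝 x, X y ∈ T i y) →
    VFSmoothNear x Y → (∀ᶠ y in 𝓝 x, Y y ∈ T j y) →
    VectorField.mlieBracket (𝓡 n) X Y x ∈ T (i + j) x

section Filtered

variable {n : ℕ} {M : Type u} [TopologicalSpace M] [ChartedSpace (EuclideanSpace ℝ (Fin n)) M]
  [IsManifold (𝓡 n) ∞ M]

namespace FilteredManifold

/-- `X` is a smooth local section of `T⁻ⁱM` around `x`, i.e. a local vector field of weighted order
at most `i`. -/
def IsSection (F : FilteredManifold n M) (i : ℕ) (x : M)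
    (X : ∀ y : M, TangentSpace (𝓡 n) y) : Prop :=
  VFSmoothNear x X ∧ ∀ᶠ y in 𝓝 x, X y ∈ F.T i y

/-- For every `x` the symbol algebra `gr(T_xM) = ⨁ T⁻ⁱ_xM / T⁻ⁱ⁺¹_xM`, with the bracket induced by
the Lie bracket of vector fields, is generated by `gr₋₁(T_xM)` as a Lie algebra: the only graded
subspace `⨁ Aᵢ / T⁻ⁱ⁺¹_xM` which contains `gr₋₁(T_xM)` and is closed under the bracket is the whole
of `gr(T_xM)`. (The subalgebra generated by `gr₋₁(T_xM)` is graded.) -/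
def GeneratedInDegreeOne (F : FilteredManifold n M) : Prop :=
  ∀ (x : M) (A : ℕ → Submodule ℝ (TangentSpace (𝓡 n) x)),
    (∀ i, F.T (i - 1) x ≤ A i ∧ A i ≤ F.T i x) →
    A 1 = F.T 1 x →
    (∀ (i j : ℕ) (X Y : ∀ y : M, TangentSpace (𝓡 n) y), F.IsSection i x X → F.IsSection j x Y →
      X x ∈ A i → Y x ∈ A j → VectorField.mlieBracket (𝓡 n) X Y x ∈ A (i + j)) →
    ∀ i, A i = F.T i x

/-- The fibre `gr₋ᵢ(T_xM) = T⁻ⁱ_xM / T⁻ⁱ⁺¹_xM`. -/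
abbrev GrFiber (F : FilteredManifold n M) (i : ℕ) (x : M) : Type :=
  F.T i x ⧸ (F.T (i - 1) x).submoduleOf (F.T i x)

theorem VFSmoothNear.zero (x : M) : VFSmoothNear x (0 : ∀ y : M, TangentSpace (𝓡 n) y) :=
  Eventually.of_forall fun _ =>
    (contMDiff_zeroSection (IB := 𝓡 n) (n := ∞) ℝ (F := EuclideanSpace ℝ (Fin n))
      (fun y : M => TangentSpace (𝓡 n) y)).contMDiffAt

/-- The bundle `gr₋ᵢ(TM)`; its smooth sections are the classes of smooth sections of `T⁻ⁱM`. -/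
abbrev gr (F : FilteredManifold n M) (i : ℕ) : SmoothBundle.{u, 0} n M where
  Fiber := F.GrFiber i
  germs x :=
    { carrier := {σ | ∃ X : ∀ y : M, F.T i y, VFSmoothNear x (fun y => (X y : TangentSpace (𝓡 n) y)) ∧
        ∀ᶠ y in 𝓝 x, σ y = Submodule.Quotient.mk (X y)}
      add_mem' := by
        rintro a b ⟨X, hX, h⟩ ⟨Y, hY, h'⟩
        refine ⟨X + Y, ?_, ?_⟩
        · filter_upwards [hX, hY] with y h1 h2 using h1.add_section h2
        · filter_upwards [h, h'] with y h1 h2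
          simp [h1, h2]
      zero_mem' := ⟨0, VFSmoothNear.zero x, Eventually.of_forall fun y => by simp⟩
      smul_mem' := by
        rintro c a ⟨X, hX, h⟩
        refine ⟨c • X, ?_, ?_⟩
        · filter_upwards [hX] with y h1 using h1.const_smul_section
        · filter_upwards [h] with y h1
          simp [h1] }
  congr' := by
    rintro x σ τ ⟨X, hX, h⟩ hst
    exact ⟨X, hX, by filter_upwards [h, hst] with y h1 h2 using h2.symm.trans h1⟩
  eventually' := by
    rintro x σ ⟨X, hX, h⟩
    filter_upwards [hX.eventually, eventually_eventually_nhds.2 h] with y h1 h2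
    exact ⟨X, h1, h2⟩
  smul' := by
    rintro x f σ hf ⟨X, hX, h⟩
    refine ⟨fun y => f y • X y, ?_, ?_⟩
    · filter_upwards [hX, hf] with y h1 h2 using h2.smul_section h1
    · filter_upwards [h] with y h1
      simp [h1]

/-- `D` is, around `x`, a linear differential operator on functions of weighted order at most `r`:
a finite sum of terms `a ξ₁ ⋯ ξₛ` with a smooth function `a` and local vector fields `ξⱼ` whose
weighted orders are at most `wⱼ ≥ 1` with `w₁ + ⋯ + wₛ ≤ r`. -/
def IsOperator (F : FilteredManifold n M) (r : ℕ) (x : M) (D : (M → ℝ) → M → ℝ) : Prop :=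
  ∃ (m : ℕ) (a : Fin m → M → ℝ) (L : Fin m → List (ℕ × (∀ y : M, TangentSpace (𝓡 n) y))),
    (∀ k, SmoothNear n x (a k)) ∧
    (∀ k, ∀ p ∈ L k, 1 ≤ p.1 ∧ F.IsSection p.1 x p.2) ∧
    (∀ k, ((L k).map Prod.fst).sum ≤ r) ∧
    D = fun f y => ∑ k, a k y * iterD ((L k).map Prod.snd) f y

theorem IsOperator.mono {F : FilteredManifold n M} {r s : ℕ} (h : r ≤ s) {x : M}
    {D : (M → ℝ) → M → ℝ} (hD : F.IsOperator r x D) : F.IsOperator s x D := by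
  obtain ⟨m, a, L, h1, h2, h3, h4⟩ := hD
  exact ⟨m, a, L, h1, h2, fun k => (h3 k).trans h, h4⟩

theorem IsOperator.add {F : FilteredManifold n M} {r : ℕ} {x : M} {D : (M → ℝ) → M → ℝ}
    (hD : F.IsOperator r x D) {f g : M → ℝ} (hf : SmoothNear n x f) (hg : SmoothNear n x g) :
    D (fun y => f y + g y) x = D f x + D g x := by
  obtain ⟨m, a, L, h1, h2, h3, rfl⟩ := hD
  simp only [← Finset.sum_add_distrib, ← mul_add]
  refine Finset.sum_congr rfl fun k _ => ?_
  rw [(iterD_add _ ?_ hf hg).self_of_nhds]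
  intro X hX
  obtain ⟨p, hp, rfl⟩ := List.mem_map.1 hX
  exact (h2 k p hp).2.1

theorem IsOperator.smul {F : FilteredManifold n M} {r : ℕ} {x : M} {D : (M → ℝ) → M → ℝ}
    (hD : F.IsOperator r x D) (c : ℝ) {f : M → ℝ} (hf : SmoothNear n x f) :
    D (fun y => c * f y) x = c * D f x := by
  obtain ⟨m, a, L, h1, h2, h3, rfl⟩ := hD
  simp only [Finset.mul_sum]
  refine Finset.sum_congr rfl fun k _ => ?_
  rw [(iterD_smul c _ ?_ hf).self_of_nhds]
  · ring
  intro X hX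
  obtain ⟨p, hp, rfl⟩ := List.mem_map.1 hX
  exact (h2 k p hp).2.1

/-! ### Weighted jets -/

/-- The local sections around `x` that are `r`-equivalent to zero at `x`: those `s` with
`D ⟨λ, s⟩ (x) = 0` for all differential operators `D` of weighted order at most `r` and all smooth
local sections `λ` of the dual bundle. -/
def jetZero (F : FilteredManifold n M) (r : ℕ) (V : SmoothBundle.{u, v} n M) (x : M) :
    Submodule ℝ (V.germs x) where
  carrier := {s | ∀ D, F.IsOperator r x D → ∀ φ ∈ V.dual.germs x, D (fun y => φ y (s.1 y)) x = 0}
  add_mem' := fun {a b} ha hb D hD φ hφ => by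
    have h := hD.add (SmoothBundle.pairing_smooth hφ a.2) (SmoothBundle.pairing_smooth hφ b.2)
    rw [ha D hD φ hφ, hb D hD φ hφ, add_zero] at h
    simpa using h
  zero_mem' := fun D hD φ hφ => by
    have h := hD.smul 0 (SmoothNear.const x 0)
    simpa using h
  smul_mem' := fun c a ha D hD φ hφ => by
    have h := hD.smul c (SmoothBundle.pairing_smooth hφ a.2)
    rw [ha D hD φ hφ, mul_zero] at h
    simpa using h

/-- The space `J^r_x(V)` of weighted jets of order `r` with source `x`. -/
abbrev JetFiber (F : FilteredManifold n M) (r : ℕ) (V : SmoothBundle.{u, v} n M) (x : M) :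
    Type max u v :=
  V.germs x ⧸ F.jetZero r V x

open scoped Classical in
/-- The weighted `r`-jet `j^r_x s` of a section `s` that is smooth near `x` (and `0` if `s` is not
smooth near `x`). -/
def jetAt (F : FilteredManifold n M) (r : ℕ) (V : SmoothBundle.{u, v} n M) (x : M)
    (s : ∀ y, V.Fiber y) : F.JetFiber r V x :=
  if h : s ∈ V.germs x then Submodule.Quotient.mk ⟨s, h⟩ else 0

theorem jetAt_of_mem {F : FilteredManifold n M} {r : ℕ} {V : SmoothBundle.{u, v} n M} {x : M}
    {s : ∀ y, V.Fiber y} (h : s ∈ V.germs x) :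
    F.jetAt r V x s = Submodule.Quotient.mk ⟨s, h⟩ := by
  simp [jetAt, h]

/-- The weighted jet bundle `J^r(V)`, with the smooth structure in which the smooth sections are
locally the combinations `∑ fᵢ j^r sᵢ` with smooth functions `fᵢ` and smooth sections `sᵢ` of `V`. -/
abbrev jet (F : FilteredManifold n M) (r : ℕ) (V : SmoothBundle.{u, v} n M) :
    SmoothBundle.{u, max u v} n M :=
  generatedBy (F.JetFiber r V) (fun x => {σ | ∃ s ∈ V.germs x, σ = fun y => F.jetAt r V y s})
    (by
      rintro x _ ⟨s, hs, rfl⟩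
      filter_upwards [V.eventually' hs] with y hy
      exact ⟨s, hy, rfl⟩)

theorem jetAt_mem_germs (F : FilteredManifold n M) (r : ℕ) {V : SmoothBundle.{u, v} n M} {x : M}
    {s : ∀ y, V.Fiber y} (hs : s ∈ V.germs x) :
    (fun y => F.jetAt r V y s) ∈ (F.jet r V).germs x :=
  ⟨1, fun _ _ => 1, fun _ y => F.jetAt r V y s, fun _ => SmoothNear.const x 1,
    fun _ => ⟨s, hs, rfl⟩, by simp⟩

/-- The natural projection `π^r_s : J^r_x(V) → J^s_x(V)` for `s ≤ r`. -/
def jetProj (F : FilteredManifold n M) {r s : ℕ} (h : s ≤ r) (V : SmoothBundle.{u, v} n M)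
    (x : M) : (F.jet r V).Fiber x →ₗ[ℝ] (F.jet s V).Fiber x :=
  Submodule.factor (p := F.jetZero r V x) (p' := F.jetZero s V x)
    fun _ ha D hD => ha D (hD.mono h)

/-- The subspace of `J^1_x(J^r(V))` formed by the elements `j^1_x (j^r s)`, i.e. the image of
`J^{r+1}_x(V)` under the inclusion `j^{r+1}_x s ↦ j^1_x (j^r s)`. -/
def holonomic (F : FilteredManifold n M) (r : ℕ) (V : SmoothBundle.{u, v} n M) (x : M) :
    Set ((F.jet 1 (F.jet r V)).Fiber x) :=
  {j | ∃ s ∈ V.germs x, j = F.jetAt 1 (F.jet r V) x (fun y => F.jetAt r V y s)}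

/-- The universal differential operator `j^r : Γ(U, V) → Γ(U, J^r(V))`. -/
def jetSections (F : FilteredManifold n M) (r : ℕ) (V : SmoothBundle.{u, v} n M) (U : Opens M) :
    V.sections U →ₗ[ℝ] (F.jet r V).sections U where
  toFun s := ⟨fun x => F.jetAt r V x (V.extend s.1), fun x hx => by
    refine (F.jet r V).congr' (F.jetAt_mem_germs r (s.2 x hx)) ?_
    filter_upwards [U.isOpen.mem_nhds hx] with y hy
    rw [SmoothBundle.extend_apply _ _ hy]⟩
  map_add' s t := by
    apply Subtype.ext
    funext x
    change F.jetAt r V x (V.extend (s.1 + t.1)) =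
      F.jetAt r V x (V.extend s.1) + F.jetAt r V x (V.extend t.1)
    rw [SmoothBundle.extend_add, jetAt_of_mem (s.2 x x.2), jetAt_of_mem (t.2 x x.2),
      jetAt_of_mem (add_mem (s.2 x x.2) (t.2 x x.2))]
    rfl
  map_smul' c s := by
    apply Subtype.ext
    funext x
    change F.jetAt r V x (V.extend (c • s.1)) = c • F.jetAt r V x (V.extend s.1)
    rw [SmoothBundle.extend_smul, jetAt_of_mem (s.2 x x.2),
      jetAt_of_mem (Submodule.smul_mem _ c (s.2 x x.2))]
    rfl

/-! ### The symbol of an operator of weighted order one -/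

/-- Smooth functions around `x` that vanish at `x`. -/
def vanishing (n : ℕ) {M : Type u} [TopologicalSpace M]
    [ChartedSpace (EuclideanSpace ℝ (Fin n)) M] (x : M) : Submodule ℝ (M → ℝ) where
  carrier := {f | SmoothNear n x f ∧ f x = 0}
  add_mem' := fun ha hb => ⟨ha.1.add hb.1, by simp [ha.2, hb.2]⟩
  zero_mem' := ⟨SmoothNear.const x 0, rfl⟩
  smul_mem' := fun c _ ha => ⟨(SmoothNear.const x c).mul ha.1, by simp [ha.2]⟩

/-- The class in `gr₋₁(T_xM)^*` of the differential `df(x)` of a function vanishing at `x`. -/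
def dGr (F : FilteredManifold n M) (x : M) :
    vanishing n x →ₗ[ℝ] Module.Dual ℝ (F.GrFiber 1 x) where
  toFun f := Submodule.liftQ _
    ((mvfderiv (𝓡 n) f.1 x).toLinearMap ∘ₗ (F.T 1 x).subtype) (by
      intro X hX
      have h0 : (X : TangentSpace (𝓡 n) x) ∈ F.T 0 x := hX
      rw [F.zero x, Submodule.mem_bot] at h0
      simp [h0])
  map_add' f g := by
    refine Submodule.linearMap_qext _ (LinearMap.ext fun X => ?_)
    change mvfderiv (𝓡 n) (f.1 + g.1) x X.1 = mvfderiv (𝓡 n) f.1 x X.1 + mvfderiv (𝓡 n) g.1 x X.1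
    rw [mvfderiv_add f.2.1.mdiff g.2.1.mdiff]
    rfl
  map_smul' c f := by
    refine Submodule.linearMap_qext _ (LinearMap.ext fun X => ?_)
    change mvfderiv (𝓡 n) ((fun _ : M => c) • f.1) x X.1 = c • mvfderiv (𝓡 n) f.1 x X.1
    rw [mvfderiv_smul (SmoothNear.const x c).mdiff f.2.1.mdiff, mvfderiv_const]
    simp

theorem dGr_mk (F : FilteredManifold n M) (x : M) (f : vanishing n x) (X : F.T 1 x) :
    F.dGr x f (Submodule.Quotient.mk X) = mvfderiv (𝓡 n) f.1 x X.1 := rfl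

theorem dGr_surjective (F : FilteredManifold n M) (x : M) : Function.Surjective (F.dGr x) := by
  intro ψ
  obtain ⟨l, hl⟩ := LinearMap.exists_extend (p := F.T 1 x)
    (ψ ∘ₗ ((F.T 0 x).submoduleOf (F.T 1 x)).mkQ)
  let l' : EuclideanSpace ℝ (Fin n) →L[ℝ] ℝ :=
    LinearMap.toContinuousLinearMap (l : EuclideanSpace ℝ (Fin n) →ₗ[ℝ] ℝ)
  have hd : HasMFDerivAt (𝓡 n) 𝓘(ℝ, EuclideanSpace ℝ (Fin n)) (extChartAt (𝓡 n) x) x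
      (ContinuousLinearMap.id ℝ (TangentSpace (𝓡 n) x)) := by
    have h1 := (mdifferentiableAt_extChartAt (I := 𝓡 n)
      (ChartedSpace.mem_chart_source (H := EuclideanSpace ℝ (Fin n)) x)).hasMFDerivAt
    rwa [mfderiv_extChartAt_self] at h1
  let f : M → ℝ := fun y => l' (extChartAt (𝓡 n) x y) - l' (extChartAt (𝓡 n) x x)
  have hs : SmoothNear n x f := by
    filter_upwards [(chartAt (EuclideanSpace ℝ (Fin n)) x).open_source.mem_nhds
      (ChartedSpace.mem_chart_source x)] with y hy
    have h1 := contMDiffAt_extChartAt' (I := 𝓡 n) (n := ∞) hy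
    exact (l'.contMDiff.contMDiffAt.comp y h1).sub contMDiffAt_const
  refine ⟨⟨f, hs, by simp [f]⟩, ?_⟩
  refine Submodule.linearMap_qext _ (LinearMap.ext fun X => ?_)
  have hd2 : mvfderiv (𝓡 n) f x = l' := by
    have h1 := ((l'.hasMFDerivAt (x := extChartAt (𝓡 n) x x)).comp x hd).sub
      (hasMFDerivAt_const (I := 𝓡 n) (I' := 𝓘(ℝ, ℝ)) (l' (extChartAt (𝓡 n) x x)) x)
    have h2 := h1.mfderiv
    ext X
    refine (DFunLike.congr_fun h2 X).trans ?_
    change l' X - 0 = l' X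
    simp
  change mvfderiv (𝓡 n) f x X.1 = ψ (Submodule.Quotient.mk X)
  rw [hd2]
  exact LinearMap.congr_fun hl X

/-- `(f, σ) ↦ j^1_x (f σ)` for functions `f` vanishing at `x` and local sections `σ` of `V`. -/
def mulJet (F : FilteredManifold n M) (V : SmoothBundle.{u, v} n M) (x : M) :
    vanishing n x →ₗ[ℝ] V.germs x →ₗ[ℝ] (F.jet 1 V).Fiber x :=
  LinearMap.mk₂ ℝ
    (fun f σ => (F.jetZero 1 V x).mkQ ⟨fun y => f.1 y • σ.1 y, V.smul' f.2.1 σ.2⟩)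
    (fun f g σ => by
      rw [← map_add]
      congr 1
      ext y
      simp [add_smul])
    (fun c f σ => by
      rw [← map_smul]
      congr 1
      ext y
      simp [mul_smul])
    (fun f σ τ => by
      rw [← map_add]
      congr 1
      ext y
      simp)
    (fun c f σ => by
      rw [← map_smul]
      congr 1
      ext y
      exact smul_comm (f.1 y) c (σ.1 y))

theorem mulJet_eq_zero (F : FilteredManifold n M) (V : SmoothBundle.{u, v} n M) (x : M)
    (f : vanishing n x) (σ : V.germs x) (h : F.dGr x f = 0 ∨ σ.1 x = 0) :
    F.mulJet V x f σ = 0 := by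
  refine (Submodule.Quotient.mk_eq_zero _).2 ?_
  rintro D ⟨m, a, L, h1, h2, h3, rfl⟩ φ hφ
  refine Finset.sum_eq_zero fun k _ => mul_eq_zero_of_right _ ?_
  have hfx : f.1 x = 0 := f.2.2
  have hmul : (fun y => φ y (f.1 y • σ.1 y)) = fun y => f.1 y * φ y (σ.1 y) := by
    funext y
    simp
  change iterD _ (fun y => φ y (f.1 y • σ.1 y)) x = 0
  rw [hmul]
  have h2k := h2 k
  have h3k := h3 k
  match hL : L k with
  | [] => simp [iterD, hfx]
  | [p] =>
    rw [hL] at h2k h3k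
    obtain ⟨hp1, hp2⟩ := h2k p (by simp)
    have hp : p.1 = 1 := by
      simp at h3k
      omega
    rw [hp] at hp2
    change lieD p.2 (fun y => f.1 y * φ y (σ.1 y)) x = 0
    rw [lieD_mul p.2 f.2.1 (V.pairing_smooth hφ σ.2), hfx]
    rcases h with h | h
    · have h5 : lieD p.2 f.1 x = 0 :=
        LinearMap.congr_fun h (Submodule.Quotient.mk ⟨p.2 x, hp2.2.self_of_nhds⟩)
      simp [h5]
    · simp [h]
  | p :: q :: L' =>
    rw [hL] at h2k h3k
    have hp := (h2k p (by simp)).1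
    have hq := (h2k q (by simp)).1
    simp at h3k
    omega

/-- The linear map `C → D` induced by `g` along the surjection `f`. -/
def descend {A B C : Type*} [AddCommGroup A] [Module ℝ A] [AddCommGroup B] [Module ℝ B]
    [AddCommGroup C] [Module ℝ C] (f : A →ₗ[ℝ] B) (hf : Function.Surjective f) (g : A →ₗ[ℝ] C)
    (h : LinearMap.ker f ≤ LinearMap.ker g) : B →ₗ[ℝ] C :=
  (LinearMap.ker f).liftQ g h ∘ₗ (f.quotKerEquivOfSurjective hf).symm.toLinearMap

theorem descend_apply {A B C : Type*} [AddCommGroup A] [Module ℝ A] [AddCommGroup B] [Module ℝ B]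
    [AddCommGroup C] [Module ℝ C] (f : A →ₗ[ℝ] B) (hf : Function.Surjective f) (g : A →ₗ[ℝ] C)
    (h : LinearMap.ker f ≤ LinearMap.ker g) (a : A) : descend f hf g h (f a) = g a := by
  have : (f.quotKerEquivOfSurjective hf).symm (f a) = Submodule.Quotient.mk a := by
    rw [LinearEquiv.symm_apply_eq]
    rfl
  simp [descend, this]

/-- The natural inclusion `ι : gr₋₁(T_xM)^* ⊗ V_x → J^1_x(V)`, whose image is the kernel of the
projection to `V_x`. It is determined by `ι (df ⊗ σ(x)) = j^1_x (f σ)` for `f` vanishing at `x`. -/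
def symbolInclusion (F : FilteredManifold n M) (V : SmoothBundle.{u, v} n M) (hV : V.Spanned)
    (x : M) : Module.Dual ℝ (F.GrFiber 1 x) ⊗[ℝ] V.Fiber x →ₗ[ℝ] (F.jet 1 V).Fiber x :=
  TensorProduct.lift (descend (F.dGr x) (F.dGr_surjective x)
    (descend (V.evalAt x) (SmoothBundle.evalAt_surjective hV x) (F.mulJet V x).flip
      (fun σ hσ => LinearMap.ext fun f => F.mulJet_eq_zero V x f σ (Or.inr hσ))).flip
    (fun f hf => by
      refine LinearMap.ext fun v => ?_
      obtain ⟨σ, hσ, rfl⟩ := hV x v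
      exact (LinearMap.congr_fun (descend_apply (V.evalAt x) _ (F.mulJet V x).flip _ ⟨σ, hσ⟩)
        f).trans (F.mulJet_eq_zero V x f ⟨σ, hσ⟩ (Or.inl hf))))

theorem symbolInclusion_apply (F : FilteredManifold n M) (V : SmoothBundle.{u, v} n M)
    (hV : V.Spanned) (x : M) (f : vanishing n x) {σ : ∀ y, V.Fiber y} (hσ : σ ∈ V.germs x) :
    F.symbolInclusion V hV x (F.dGr x f ⊗ₜ[ℝ] σ x) =
      F.jetAt 1 V x (fun y => f.1 y • σ y) := by
  rw [jetAt_of_mem (V.smul' f.2.1 hσ), symbolInclusion, TensorProduct.lift.tmul]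
  refine (LinearMap.congr_fun (descend_apply (F.dGr x) _ _ _ f) (σ x)).trans ?_
  exact LinearMap.congr_fun (descend_apply (V.evalAt x) (SmoothBundle.evalAt_surjective hV x) (F.mulJet V x).flip _ ⟨σ, hσ⟩) f

/-- The symbol at `x` of a differential operator `S : J^1(V) → W` of weighted order one: its
restriction to `gr₋₁(T_xM)^* ⊗ V_x`. -/
def symbol (F : FilteredManifold n M) {V : SmoothBundle.{u, v} n M} (hV : V.Spanned)
    {W : SmoothBundle.{u, w} n M} (S : (F.jet 1 V).Hom W) (x : M) :
    Module.Dual ℝ (F.GrFiber 1 x) ⊗[ℝ] V.Fiber x →ₗ[ℝ] W.Fiber x :=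
  S.app x ∘ₗ F.symbolInclusion V hV x

theorem jet_spanned (F : FilteredManifold n M) (r : ℕ) (V : SmoothBundle.{u, v} n M) :
    (F.jet r V).Spanned := by
  intro x j
  obtain ⟨s, rfl⟩ := Submodule.Quotient.mk_surjective _ j
  exact ⟨_, F.jetAt_mem_germs r s.2, jetAt_of_mem s.2⟩

/-- The bundle `gr₋₁(TM)^* ⊗ J^s(V)`. -/
abbrev spencerTarget (F : FilteredManifold n M) (s : ℕ) (V : SmoothBundle.{u, v} n M) :
    SmoothBundle.{u, max u v} n M :=
  (F.gr 1).dual.tensor (F.jet s V)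

/-- `S : J^1(J^r(V)) → gr₋₁(TM)^* ⊗ J^{r-1}(V)` vanishes on `J^{r+1}(V)` and has symbol
`id ⊗ π^r_{r-1}`. -/
def IsSpencerOperator (F : FilteredManifold n M) (r : ℕ) (V : SmoothBundle.{u, v} n M)
    (S : (F.jet 1 (F.jet r V)).Hom (F.spencerTarget (r - 1) V)) : Prop :=
  (∀ x, ∀ j ∈ F.holonomic r V x, S.app x j = 0) ∧
  ∀ x, F.symbol (F.jet_spanned r V) S x =
    TensorProduct.map (LinearMap.id : Module.Dual ℝ (F.GrFiber 1 x) →ₗ[ℝ] _)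
      (F.jetProj (Nat.sub_le r 1) V x)

end FilteredManifold

end Filtered

end

end WeightedJet

/-! Write a local section of J^r(E) as σ = ∑ fₖ j^r sₖ. Splitting each fₖ into its value at x and a
function vanishing at x shows that an operator which kills holonomic jets and has the prescribed
symbol must send j^1_x σ to ∑ dfₖ(x) ⊗ j^{r-1}_x sₖ, with dfₖ(x) restricted to gr₋₁. This gives
uniqueness, and existence amounts to this formula being well defined.

Jets are tested by words: j^r_x s = 0 means (ξ₁ ⋯ ξₗ ⟨φ, s⟩)(x) = 0 for all words of weight at most
r and all local dual sections φ. For such a word L, the rule j^r s ↦ L⟨φ, s⟩ is a smooth section of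
the dual of J^r(E) (`wordForm`). Let j^1_x σ = 0, let X have weight one and L weight at most r - 1.
Differentiating the form of L on σ along X and subtracting the form of X L on σ leaves ∑ (X fₖ)(x)
(L⟨φ, sₖ⟩)(x) = 0 (`sum_lieD_word_eq_zero`). This is the well-definedness.

For exactness, S(j^1 σ) = 0 says that ∑ (X fₖ) j^{r-1} sₖ = 0 for X of weight one. By induction ∑ (Y
fₖ) j^{r-i} sₖ = 0 for every Y of weight i ≤ r (`T_le_spencerKernel`): differentiating such
relations gives relations for X Y fₖ, antisymmetrising gives them for [X, Y] fₖ, and gr₋₁ generates.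
By the Leibniz rule L⟨φ, ∑ fₖ sₖ⟩ = ∑ fₖ L⟨φ, sₖ⟩ for all words of weight at most r
(`sum_mul_word_eq`), so σ = j^r(∑ fₖ sₖ). The section ∑ fₖ sₖ is the projection of σ to E, hence
independent of the local presentation and defined wherever σ is. -/

namespace WeightedJet

universe u v w

/-! ### The Lie bracket as a commutator of derivations -/

section LieDerivative

variable {n : ℕ} {M : Type u} [TopologicalSpace M] [ChartedSpace (EuclideanSpace ℝ (Fin n)) M]

theorem SmoothNear.contDiffAt_chart {x : M} {f : M → ℝ} (hf : SmoothNear n x f) :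
    ContDiffAt ℝ ∞ (f ∘ (extChartAt (𝓡 n) x).symm) (extChartAt (𝓡 n) x x) := by
  have h := (contMDiffAt_iff.1 hf.at).2
  simp only [extChartAt_model_space_eq_id, modelWithCornersSelf_coe, Set.range_id,
    contDiffWithinAt_univ] at h
  exact h

theorem eventually_nhds_chart {x : M} {p : M → Prop} (h : ∀ᶠ y in 𝓝 x, p y) :
    ∀ᶠ u in 𝓝 (extChartAt (𝓡 n) x x),
      u ∈ (extChartAt (𝓡 n) x).target ∧ p ((extChartAt (𝓡 n) x).symm u) := by
  refine Eventually.and (extChartAt_target_mem_nhds (I := 𝓡 n) x) ?_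
  have h1 := continuousAt_extChartAt_symm (I := 𝓡 n) x
  rw [ContinuousAt, extChartAt_to_inv] at h1
  exact h1.eventually h

variable [IsManifold (𝓡 n) ∞ M]

/-- The vector field `X` in the preferred chart at `x`. -/
noncomputable def chartVF (x : M) (X : ∀ y : M, TangentSpace (𝓡 n) y) :
    EuclideanSpace ℝ (Fin n) → EuclideanSpace ℝ (Fin n) :=
  VectorField.mpullbackWithin 𝓘(ℝ, EuclideanSpace ℝ (Fin n)) (𝓡 n) (extChartAt (𝓡 n) x).symm X
    (Set.range (𝓡 n))

theorem fderiv_comp_extChartAt_symm {x : M} {f : M → ℝ} {u : EuclideanSpace ℝ (Fin n)}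
    (hu : u ∈ (extChartAt (𝓡 n) x).target)
    (hf : MDifferentiableAt (𝓡 n) 𝓘(ℝ, ℝ) f ((extChartAt (𝓡 n) x).symm u)) :
    fderiv ℝ (f ∘ (extChartAt (𝓡 n) x).symm) u =
      (mvfderiv (𝓡 n) f ((extChartAt (𝓡 n) x).symm u)).comp
        (mfderivWithin 𝓘(ℝ, EuclideanSpace ℝ (Fin n)) (𝓡 n)
        (extChartAt (𝓡 n) x).symm (Set.range (𝓡 n)) u) := by
  have : IsManifold (𝓡 n) 1 M := IsManifold.of_le (n := ∞) (by simp)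
  have h1 := mvfderiv_comp_mfderivWithin (I := 𝓡 n) (g := f)
    u (s := Set.range (𝓡 n)) hf
    (mdifferentiableWithinAt_extChartAt_symm (I := 𝓡 n) hu)
    (by simp [uniqueMDiffWithinAt_univ])
  rw [← h1]
  ext v
  simp only [modelWithCornersSelf_coe, Set.range_id, mvfderivWithin_univ]
  change _ = mfderiv 𝓘(ℝ, EuclideanSpace ℝ (Fin n)) 𝓘(ℝ, ℝ) _ u v
  rw [mfderiv_eq_fderiv]
  rfl

/-- The chart field is X pulled back by the inverse of the derivative of the inverse chart. That
derivative is invertible on the target, so it cancels in the chain rule. -/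
theorem fderiv_comp_extChartAt_symm_apply {x : M} {f : M → ℝ} {u : EuclideanSpace ℝ (Fin n)}
    (hu : u ∈ (extChartAt (𝓡 n) x).target)
    (hf : MDifferentiableAt (𝓡 n) 𝓘(ℝ, ℝ) f ((extChartAt (𝓡 n) x).symm u))
    (X : ∀ y : M, TangentSpace (𝓡 n) y) :
    fderiv ℝ (f ∘ (extChartAt (𝓡 n) x).symm) u (chartVF x X u) =
      lieD X f ((extChartAt (𝓡 n) x).symm u) := by
  have : IsManifold (𝓡 n) 1 M := IsManifold.of_le (n := ∞) (by simp)
  rw [fderiv_comp_extChartAt_symm hu hf]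
  obtain ⟨e, he⟩ := isInvertible_mfderivWithin_extChartAt_symm (I := 𝓡 n) hu
  change mvfderiv (𝓡 n) f _ (mfderivWithin 𝓘(ℝ, EuclideanSpace ℝ (Fin n)) (𝓡 n)
        (extChartAt (𝓡 n) x).symm (Set.range (𝓡 n)) u (VectorField.mpullbackWithin _ _ _ _ _ _)) = _
  rw [VectorField.mpullbackWithin_apply, ← he, ContinuousLinearMap.inverse_equiv]
  exact congrArg (mvfderiv (𝓡 n) f ((extChartAt (𝓡 n) x).symm u)) (e.apply_symm_apply _)

theorem VFSmoothNear.differentiableAt_chart {x : M} {X : ∀ y : M, TangentSpace (𝓡 n) y}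
    (hX : VFSmoothNear x X) :
    DifferentiableAt ℝ (chartVF x X) (extChartAt (𝓡 n) x x) := by
  have : IsManifold (𝓡 n) (1 + 1) M := IsManifold.of_le (n := ∞) (by norm_cast)
  have h := MDifferentiableWithinAt.differentiableWithinAt_mpullbackWithin_vectorField
    (I := 𝓡 n) (s := Set.univ) (V := X) (x := x)
    (hX.self_of_nhds.mdifferentiableAt (by simp)).mdifferentiableWithinAt
  have hr : (extChartAt (𝓡 n) x).symm ⁻¹' Set.univ ∩ Set.range (𝓡 n) = Set.univ := by simp
  rw [hr] at h
  exact differentiableWithinAt_univ.1 h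

theorem lieD_eq_fderiv_chart {x : M} {f : M → ℝ} (hf : SmoothNear n x f)
    (X : ∀ y : M, TangentSpace (𝓡 n) y) :
    lieD X f x = fderiv ℝ (f ∘ (extChartAt (𝓡 n) x).symm) (extChartAt (𝓡 n) x x)
      (chartVF x X (extChartAt (𝓡 n) x x)) := by
  rw [fderiv_comp_extChartAt_symm_apply (mem_extChartAt_target x)
    (by rw [extChartAt_to_inv]; exact hf.mdiff), extChartAt_to_inv]

/-- The chart formula for Y · f holds at all points near x, so it can be differentiated once more.
-/
theorem lieD_lieD_eq_fderiv_chart {x : M} {f : M → ℝ} (hf : SmoothNear n x f)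
    (X : ∀ y : M, TangentSpace (𝓡 n) y) {Y : ∀ y : M, TangentSpace (𝓡 n) y}
    (hY : VFSmoothNear x Y) :
    lieD X (lieD Y f) x = fderiv ℝ (fun u => fderiv ℝ (f ∘ (extChartAt (𝓡 n) x).symm) u
      (chartVF x Y u)) (extChartAt (𝓡 n) x x) (chartVF x X (extChartAt (𝓡 n) x x)) := by
  rw [lieD_eq_fderiv_chart (hf.lieD hY)]
  congr 1
  refine Filter.EventuallyEq.fderiv_eq ?_
  filter_upwards [eventually_nhds_chart hf.eventually] with u hu
  exact (fderiv_comp_extChartAt_symm_apply hu.1 hu.2.mdiff Y).symm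

/-- The Lie bracket of vector fields acts on functions as the commutator. -/
theorem lieD_mlieBracket {x : M} {f : M → ℝ} (hf : SmoothNear n x f)
    {X Y : ∀ y : M, TangentSpace (𝓡 n) y} (hX : VFSmoothNear x X) (hY : VFSmoothNear x Y) :
    lieD (VectorField.mlieBracket (𝓡 n) X Y) f x = lieD X (lieD Y f) x - lieD Y (lieD X f) x := by
  have : IsManifold (𝓡 n) 1 M := IsManifold.of_le (n := ∞) (by simp)
  -- In the chart the commutator is the derivative of f along the bracket of the chart fields, by
  -- the symmetry of the second derivative. It remains to carry this bracket back to M.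
  rw [lieD_lieD_eq_fderiv_chart hf X hY, lieD_lieD_eq_fderiv_chart hf Y hX,
    ← VectorField.fderiv_apply_lieBracket (hf.contDiffAt_chart.of_le (by norm_cast)) (n := 2) (by simp)
      hY.differentiableAt_chart hX.differentiableAt_chart,
    fderiv_comp_extChartAt_symm (mem_extChartAt_target x)
      (by rw [extChartAt_to_inv]; exact hf.mdiff)]
  set L := VectorField.lieBracket ℝ (chartVF x X) (chartVF x Y) (extChartAt (𝓡 n) x x) with hL
  obtain ⟨e, he⟩ := isInvertible_mfderivWithin_extChartAt_symm (I := 𝓡 n)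
    (mem_extChartAt_target (I := 𝓡 n) x)
  -- The bracket on M is defined with the inverse of the derivative of the chart, while the chain
  -- rule produced the derivative `e` of the inverse chart. Both carry `L` to the same vector.
  have h1 := VectorField.mfderiv_extChartAt_inverse_comp_mfderivWithin_extChartAT_symm
    (I := 𝓡 n) (x := x) (e L)
  have h2 : VectorField.mlieBracket (𝓡 n) X Y x =
      (mfderiv (𝓡 n) 𝓘(ℝ, EuclideanSpace ℝ (Fin n)) (extChartAt (𝓡 n) x) x).inverse L := by
    rw [← VectorField.mlieBracketWithin_univ, VectorField.mlieBracketWithin_apply]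
    have hr : (extChartAt (𝓡 n) x).symm ⁻¹' Set.univ ∩ Set.range (𝓡 n) = Set.univ := by simp
    have h5 : VectorField.lieBracketWithin ℝ (chartVF x X) (chartVF x Y) Set.univ
        (extChartAt (𝓡 n) x x) = L := by rw [VectorField.lieBracketWithin_univ]
    rw [hr]
    exact congrArg _ h5
  have h3 : (mfderivWithin 𝓘(ℝ, EuclideanSpace ℝ (Fin n)) (𝓡 n) (extChartAt (𝓡 n) x).symm
      (Set.range (𝓡 n)) (extChartAt (𝓡 n) x x)).inverse (e L) = L := by
    rw [← he, ContinuousLinearMap.inverse_equiv]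
    exact e.symm_apply_apply L
  have h4 : VectorField.mlieBracket (𝓡 n) X Y x = e L := by
    rw [h2]
    refine Eq.trans ?_ h1
    exact congrArg _ h3.symm
  rw [lieD, h4, ← he, extChartAt_to_inv]
  rfl

end LieDerivative
end WeightedJet

namespace WeightedJet

universe u v w

noncomputable section

/-! ### Jets tested by words in weighted vector fields -/

section LieDerivative

variable {n : ℕ} {M : Type u} [TopologicalSpace M] [ChartedSpace (EuclideanSpace ℝ (Fin n)) M]

theorem lieD_sum {x : M} {m : ℕ} {f : Fin m → M → ℝ} (X : ∀ y : M, TangentSpace (𝓡 n) y)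
    (hf : ∀ i, SmoothNear n x (f i)) :
    lieD X (fun y => ∑ i, f i y) x = ∑ i, lieD X (f i) x := by
  induction m with
  | zero => simpa using lieD_const X 0
  | succ m ih =>
    simp only [Fin.sum_univ_succ]
    rw [lieD_add X (hf 0) (SmoothNear.sum _ fun i _ => hf i.succ), ih fun i => hf i.succ]

theorem lieD_eq_zero {x : M} {f : M → ℝ} (X : ∀ y : M, TangentSpace (𝓡 n) y)
    (hf : ∀ᶠ y in 𝓝 x, f y = 0) : lieD X f x = 0 :=
  (lieD_congr X hf).self_of_nhds.trans (lieD_const X 0)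

end LieDerivative

namespace FilteredManifold

variable {n : ℕ} {M : Type u} [TopologicalSpace M] [ChartedSpace (EuclideanSpace ℝ (Fin n)) M]
  [IsManifold (𝓡 n) ∞ M]

/-! ### Words of local sections -/

theorem IsSection.eventually {F : FilteredManifold n M} {i : ℕ} {x : M}
    {X : ∀ y : M, TangentSpace (𝓡 n) y} (h : F.IsSection i x X) :
    ∀ᶠ y in 𝓝 x, F.IsSection i y X := by
  filter_upwards [h.1.eventually, eventually_eventually_nhds.2 h.2] with y h1 h2 using ⟨h1, h2⟩

/-- The list `L` of local vector fields with weights has total weight at most `r`. -/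
def IsWord (F : FilteredManifold n M) (r : ℕ) (x : M)
    (L : List (ℕ × (∀ y : M, TangentSpace (𝓡 n) y))) : Prop :=
  (∀ p ∈ L, 1 ≤ p.1 ∧ F.IsSection p.1 x p.2) ∧ (L.map Prod.fst).sum ≤ r

theorem IsWord.eventually {F : FilteredManifold n M} {r : ℕ} {x : M}
    {L : List (ℕ × (∀ y : M, TangentSpace (𝓡 n) y))} (h : F.IsWord r x L) :
    ∀ᶠ y in 𝓝 x, F.IsWord r y L := by
  have h1 : ∀ᶠ y in 𝓝 x, ∀ p ∈ L, 1 ≤ p.1 ∧ F.IsSection p.1 y p.2 := by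
    have h2 := h.1
    clear h
    induction L with
    | nil => simp
    | cons p L ih =>
      filter_upwards [ih fun q hq => h2 q (by simp [hq]), (h2 p (by simp)).2.eventually]
        with y h3 h4 q hq
      rcases List.mem_cons.1 hq with rfl | hq
      · exact ⟨(h2 q (by simp)).1, h4⟩
      · exact h3 q hq
  exact h1.mono fun y hy => ⟨hy, h.2⟩

theorem IsWord.mono {F : FilteredManifold n M} {r s : ℕ} (hrs : r ≤ s) {x : M}
    {L : List (ℕ × (∀ y : M, TangentSpace (𝓡 n) y))} (h : F.IsWord r x L) : F.IsWord s x L :=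
  ⟨h.1, h.2.trans hrs⟩

theorem IsWord.cons {F : FilteredManifold n M} {r i : ℕ} {x : M} (hi : 1 ≤ i)
    {X : ∀ y : M, TangentSpace (𝓡 n) y} (hX : F.IsSection i x X)
    {L : List (ℕ × (∀ y : M, TangentSpace (𝓡 n) y))} (h : F.IsWord r x L) :
    F.IsWord (i + r) x ((i, X) :: L) := by
  refine ⟨fun p hp => ?_, by simpa using h.2⟩
  rcases List.mem_cons.1 hp with rfl | hp
  · exact ⟨hi, hX⟩
  · exact h.1 p hp

theorem IsWord.nil (F : FilteredManifold n M) (r : ℕ) (x : M) : F.IsWord r x [] :=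
  ⟨by simp, by simp⟩

theorem IsWord.vfSmoothNear {F : FilteredManifold n M} {r : ℕ} {x : M}
    {L : List (ℕ × (∀ y : M, TangentSpace (𝓡 n) y))} (h : F.IsWord r x L) :
    ∀ X ∈ L.map Prod.snd, VFSmoothNear x X := by
  intro X hX
  obtain ⟨p, hp, rfl⟩ := List.mem_map.1 hX
  exact (h.1 p hp).2.1

theorem IsWord.isOperator {F : FilteredManifold n M} {r : ℕ} {x : M}
    {L : List (ℕ × (∀ y : M, TangentSpace (𝓡 n) y))} (h : F.IsWord r x L) :
    F.IsOperator r x (iterD (L.map Prod.snd)) :=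
  ⟨1, fun _ _ => 1, fun _ => L, fun _ => SmoothNear.const x 1, fun _ => h.1, fun _ => h.2, by
    funext f y
    simp⟩

/-- The coefficient functions of an operator enter only through their values at x, so single words
without coefficients suffice as tests. -/
theorem mem_jetZero_iff (F : FilteredManifold n M) {r : ℕ} {V : SmoothBundle.{u, v} n M} {x : M}
    {s : V.germs x} : s ∈ F.jetZero r V x ↔ ∀ L, F.IsWord r x L → ∀ φ ∈ V.dual.germs x,
      iterD (L.map Prod.snd) (fun y => φ y (s.1 y)) x = 0 := by
  refine ⟨fun h L hL φ hφ => h _ hL.isOperator φ hφ, ?_⟩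
  rintro h D ⟨m, a, L, h1, h2, h3, rfl⟩ φ hφ
  exact Finset.sum_eq_zero fun k _ => mul_eq_zero_of_right _ (h (L k) ⟨h2 k, h3 k⟩ φ hφ)

/-! ### Jets of local sections -/

section Jets

variable (F : FilteredManifold n M) {r : ℕ} {V : SmoothBundle.{u, v} n M} {x : M}

theorem jetAt_eq_zero_iff {s : ∀ y, V.Fiber y} (hs : s ∈ V.germs x) :
    F.jetAt r V x s = 0 ↔ ∀ L, F.IsWord r x L → ∀ φ ∈ V.dual.germs x,
      iterD (L.map Prod.snd) (fun y => φ y (s y)) x = 0 := by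
  rw [jetAt_of_mem hs, Submodule.Quotient.mk_eq_zero, mem_jetZero_iff]

theorem jetAt_add {s t : ∀ y, V.Fiber y} (hs : s ∈ V.germs x) (ht : t ∈ V.germs x) :
    F.jetAt r V x (s + t) = F.jetAt r V x s + F.jetAt r V x t := by
  rw [jetAt_of_mem hs, jetAt_of_mem ht, jetAt_of_mem (add_mem hs ht)]
  rfl

theorem jetAt_smul (c : ℝ) {s : ∀ y, V.Fiber y} (hs : s ∈ V.germs x) :
    F.jetAt r V x (c • s) = c • F.jetAt r V x s := by
  rw [jetAt_of_mem hs, jetAt_of_mem (Submodule.smul_mem _ c hs)]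
  rfl

theorem jetAt_zero : F.jetAt r V x 0 = 0 := by
  rw [jetAt_of_mem (zero_mem _)]
  rfl

theorem jetAt_sub {s t : ∀ y, V.Fiber y} (hs : s ∈ V.germs x) (ht : t ∈ V.germs x) :
    F.jetAt r V x (s - t) = F.jetAt r V x s - F.jetAt r V x t := by
  rw [jetAt_of_mem hs, jetAt_of_mem ht, jetAt_of_mem (sub_mem hs ht)]
  rfl

theorem jetAt_sum {m : ℕ} {s : Fin m → ∀ y, V.Fiber y} (hs : ∀ i, s i ∈ V.germs x) :
    F.jetAt r V x (∑ i, s i) = ∑ i, F.jetAt r V x (s i) := by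
  induction m with
  | zero => simpa using F.jetAt_zero
  | succ m ih =>
    rw [Fin.sum_univ_succ, Fin.sum_univ_succ,
      F.jetAt_add (hs 0) (sum_mem fun i _ => hs i.succ), ih fun i => hs i.succ]

theorem jetAt_congr {s t : ∀ y, V.Fiber y} (hs : s ∈ V.germs x) (h : ∀ᶠ y in 𝓝 x, s y = t y) :
    F.jetAt r V x s = F.jetAt r V x t := by
  have ht := V.congr' hs h
  rw [← sub_eq_zero, ← F.jetAt_sub hs ht, F.jetAt_eq_zero_iff (sub_mem hs ht)]
  intro L hL φ hφ
  rw [(iterD_congr _ (g := fun _ => 0) (h.mono fun y hy => by simp [hy])).self_of_nhds]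
  simpa using hL.isOperator.smul 0 (SmoothNear.const (n := n) x 0)

theorem jetProj_jetAt {s : ℕ} (h : s ≤ r) {σ : ∀ y, V.Fiber y} (hσ : σ ∈ V.germs x) :
    F.jetProj h V x (F.jetAt r V x σ) = F.jetAt s V x σ := by
  rw [jetAt_of_mem hσ, jetAt_of_mem hσ]
  rfl

open scoped Classical in
/-- The linear form `j^r_y s ↦ (ξ₁ ⋯ ξₗ ⟨φ, s⟩)(y)` on `r`-jets. -/
def wordForm (r : ℕ) (V : SmoothBundle.{u, v} n M)
    (L : List (ℕ × (∀ y : M, TangentSpace (𝓡 n) y)))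
    (φ : ∀ y, Module.Dual ℝ (V.Fiber y)) (y : M) : Module.Dual ℝ (F.JetFiber r V y) :=
  -- Both conditions persist on a neighbourhood of a point where they hold, so the default value
  -- does not affect the germ there.
  if h : F.IsWord r y L ∧ φ ∈ V.dual.germs y then
    Submodule.liftQ (F.jetZero r V y)
      { toFun := fun s => iterD (L.map Prod.snd) (fun z => φ z (s.1 z)) y
        map_add' := fun s t => by
          simpa using h.1.isOperator.add (SmoothBundle.pairing_smooth h.2 s.2)
            (SmoothBundle.pairing_smooth h.2 t.2)
        map_smul' := fun c s => by
          simpa using h.1.isOperator.smul c (SmoothBundle.pairing_smooth h.2 s.2) }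
      fun s hs => F.mem_jetZero_iff.1 hs L h.1 φ h.2
  else 0

theorem wordForm_jetAt {L : List (ℕ × (∀ y : M, TangentSpace (𝓡 n) y))} (hL : F.IsWord r x L)
    {φ : ∀ y, Module.Dual ℝ (V.Fiber y)} (hφ : φ ∈ V.dual.germs x) {s : ∀ y, V.Fiber y}
    (hs : s ∈ V.germs x) :
    F.wordForm r V L φ x (F.jetAt r V x s) =
      iterD (L.map Prod.snd) (fun z => φ z (s z)) x := by
  rw [wordForm, dif_pos ⟨hL, hφ⟩, jetAt_of_mem hs]
  rfl

theorem wordForm_sum {L : List (ℕ × (∀ y : M, TangentSpace (𝓡 n) y))} (hL : F.IsWord r x L)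
    {φ : ∀ y, Module.Dual ℝ (V.Fiber y)} (hφ : φ ∈ V.dual.germs x) {m : ℕ} (f : Fin m → M → ℝ)
    {s : Fin m → ∀ y, V.Fiber y} (hs : ∀ i, s i ∈ V.germs x) {σ : ∀ y, (F.jet r V).Fiber y}
    (hσ : ∀ᶠ y in 𝓝 x, σ y = ∑ i, f i y • F.jetAt r V y (s i)) :
    ∀ᶠ y in 𝓝 x, F.wordForm r V L φ y (σ y) =
      ∑ i, f i y * iterD (L.map Prod.snd) (fun z => φ z (s i z)) y := by
  filter_upwards [hL.eventually, V.dual.eventually' hφ,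
    eventually_all.2 fun i => V.eventually' (hs i), hσ] with y h1 h2 h3 h4
  rw [h4, map_sum]
  refine Finset.sum_congr rfl fun i _ => ?_
  rw [map_smul, F.wordForm_jetAt h1 h2 (h3 i), smul_eq_mul]

theorem exists_jet_sum {σ : ∀ y, (F.jet r V).Fiber y} (hσ : σ ∈ (F.jet r V).germs x) :
    ∃ (m : ℕ) (f : Fin m → M → ℝ) (s : Fin m → ∀ y, V.Fiber y),
      (∀ i, SmoothNear n x (f i)) ∧ (∀ i, s i ∈ V.germs x) ∧
      ∀ᶠ y in 𝓝 x, σ y = ∑ i, f i y • F.jetAt r V y (s i) := by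
  obtain ⟨m, f, g, hf, hg, h⟩ := hσ
  choose s hs hgs using hg
  exact ⟨m, f, s, hf, hs, h.mono fun y hy => by simp [hy, hgs]⟩

theorem smoothNear_word {L : List (ℕ × (∀ y : M, TangentSpace (𝓡 n) y))} (hL : F.IsWord r x L)
    {φ : ∀ y, Module.Dual ℝ (V.Fiber y)} (hφ : φ ∈ V.dual.germs x) {s : ∀ y, V.Fiber y}
    (hs : s ∈ V.germs x) :
    SmoothNear n x (iterD (L.map Prod.snd) (fun z => φ z (s z))) :=
  (SmoothBundle.pairing_smooth hφ hs).iterD hL.vfSmoothNear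

/-- On ∑ fᵢ j^r sᵢ the form takes the smooth value ∑ fᵢ L⟨φ, sᵢ⟩. Word forms may therefore serve as
dual sections when 1-jets of sections of J^r(V) are tested. -/
theorem wordForm_mem_germs {L : List (ℕ × (∀ y : M, TangentSpace (𝓡 n) y))}
    (hL : F.IsWord r x L) {φ : ∀ y, Module.Dual ℝ (V.Fiber y)} (hφ : φ ∈ V.dual.germs x) :
    F.wordForm r V L φ ∈ (F.jet r V).dual.germs x := by
  change ∀ᶠ y in 𝓝 x, ∀ σ ∈ (F.jet r V).germs y,
    SmoothNear n y (fun z => F.wordForm r V L φ z (σ z))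
  filter_upwards [hL.eventually, V.dual.eventually' hφ] with y h1 h2 σ hσ
  obtain ⟨m, f, s, hf, hs, h⟩ := F.exists_jet_sum hσ
  refine (SmoothNear.sum Finset.univ fun i _ => (hf i).mul (F.smoothNear_word h1 h2 (hs i))).congr
    ((F.wordForm_sum h1 h2 f hs h).mono fun z hz => hz.symm)

/-- If the `1`-jet at `x` of the section `∑ fᵢ j^r sᵢ` vanishes, then so does
`∑ (X · fᵢ)(x) j^{r-1}_x sᵢ` for all vector fields `X` of weighted order one. -/
theorem sum_lieD_word_eq_zero {σ : ∀ y, (F.jet r V).Fiber y} {m : ℕ} {f : Fin m → M → ℝ}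
    {s : Fin m → ∀ y, V.Fiber y} (hf : ∀ i, SmoothNear n x (f i)) (hs : ∀ i, s i ∈ V.germs x)
    (hσ : ∀ᶠ y in 𝓝 x, σ y = ∑ i, f i y • F.jetAt r V y (s i)) (hσ' : σ ∈ (F.jet r V).germs x)
    (h0 : F.jetAt 1 (F.jet r V) x σ = 0) {X : ∀ y : M, TangentSpace (𝓡 n) y}
    (hX : F.IsSection 1 x X) {L : List (ℕ × (∀ y : M, TangentSpace (𝓡 n) y))}
    {q : ℕ} (hq : 1 + q ≤ r) (hL : F.IsWord q x L)
    {φ : ∀ y, Module.Dual ℝ (V.Fiber y)} (hφ : φ ∈ V.dual.germs x) :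
    ∑ i, lieD X (f i) x * iterD (L.map Prod.snd) (fun z => φ z (s i z)) x = 0 := by
  have hL1 : F.IsWord r x L := hL.mono (by omega)
  have hL2 : F.IsWord r x ((1, X) :: L) := (hL.cons le_rfl hX).mono hq
  rw [F.jetAt_eq_zero_iff hσ'] at h0
  -- Two tests of the vanishing 1-jet. Differentiating the form of L along X gives both halves of
  -- the Leibniz rule; the value of the form of X L gives the half in which no fᵢ is differentiated.
  -- The word X L must still act on r-jets, which is why L has weight at most r - 1.
  have h1 := h0 [(1, X)] ((IsWord.nil F 0 x).cons le_rfl hX) _ (F.wordForm_mem_germs hL1 hφ)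
  have h2 := h0 [] (IsWord.nil F 1 x) _ (F.wordForm_mem_germs hL2 hφ)
  change lieD X (fun y => F.wordForm r V L φ y (σ y)) x = 0 at h1
  change F.wordForm r V ((1, X) :: L) φ x (σ x) = 0 at h2
  rw [(lieD_congr X (F.wordForm_sum hL1 hφ f hs hσ)).self_of_nhds,
    lieD_sum X fun i => (hf i).mul (F.smoothNear_word hL1 hφ (hs i))] at h1
  rw [(F.wordForm_sum hL2 hφ f hs hσ).self_of_nhds] at h2
  have h3 : ∀ i, lieD X (fun y => f i y * iterD (L.map Prod.snd) (fun z => φ z (s i z)) y) x =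
      f i x * lieD X (iterD (L.map Prod.snd) (fun z => φ z (s i z))) x +
        lieD X (f i) x * iterD (L.map Prod.snd) (fun z => φ z (s i z)) x := fun i => by
    rw [lieD_mul X (hf i) (F.smoothNear_word hL1 hφ (hs i)), mul_comm (lieD X (f i) x)]
  simp only [h3, Finset.sum_add_distrib] at h1
  change ∑ i, f i x * lieD X (iterD (L.map Prod.snd) (fun z => φ z (s i z))) x = 0 at h2
  rwa [h2, zero_add] at h1

end Jets

end FilteredManifold
end
end WeightedJet

namespace WeightedJet

universe u v w

noncomputable section

/-! ### Construction and uniqueness of the Spencer operator -/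

section Functions

variable {n : ℕ} {M : Type u} [TopologicalSpace M] [ChartedSpace (EuclideanSpace ℝ (Fin n)) M]

/-- The functions that are smooth near `x`. -/
def smoothFunctions (n : ℕ) {M : Type u} [TopologicalSpace M]
    [ChartedSpace (EuclideanSpace ℝ (Fin n)) M] (x : M) : Submodule ℝ (M → ℝ) where
  carrier := {f | SmoothNear n x f}
  add_mem' := fun ha hb => ha.add hb
  zero_mem' := SmoothNear.const x 0
  smul_mem' := fun c _ ha => (SmoothNear.const x c).mul ha

theorem smoothNear_sub_const {x : M} {f : M → ℝ} (hf : SmoothNear n x f) (c : ℝ) :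
    SmoothNear n x (fun y => f y - c) := by
  simpa [sub_eq_add_neg] using hf.add (SmoothNear.const x (-c))

end Functions

/-- For finite-dimensional A the tensor product is Hom(A, B). Tensors with values in jets can thus
be tested on vectors of gr₋₁, with no condition on B. -/
theorem dual_tensor_eq_zero {A B : Type*} [AddCommGroup A] [Module ℝ A] [FiniteDimensional ℝ A]
    [AddCommGroup B] [Module ℝ B] {t : Module.Dual ℝ A ⊗[ℝ] B}
    (h : ∀ a, dualTensorHom ℝ A B t a = 0) : t = 0 := by
  refine (dualTensorHomEquiv ℝ A B).injective ?_
  rw [map_zero]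
  exact LinearMap.ext h

theorem exists_fin_sum_tmul {A B : Type*} [AddCommGroup A] [Module ℝ A] [AddCommGroup B]
    [Module ℝ B] (t : A ⊗[ℝ] B) : ∃ (m : ℕ) (a : Fin m → A) (b : Fin m → B),
      t = ∑ i, a i ⊗ₜ b i := by
  induction t with
  | zero => exact ⟨0, fun i => i.elim0, fun i => i.elim0, by simp⟩
  | tmul a b => exact ⟨1, fun _ => a, fun _ => b, by simp⟩
  | add t u ht hu =>
    obtain ⟨m, a, b, rfl⟩ := ht
    obtain ⟨m', a', b', rfl⟩ := hu
    exact ⟨m + m', Fin.append a a', Fin.append b b', by simp [Fin.sum_univ_add]⟩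

/-- Meant for p = `jetParam` and q = `spencerParam`: the Spencer operator is the factorisation of q
through p. -/
theorem exists_descend_tensor {A B C A' B' : Type*} [AddCommGroup A] [Module ℝ A] [AddCommGroup B]
    [Module ℝ B] [AddCommGroup C] [Module ℝ C] [AddCommGroup A'] [Module ℝ A'] [AddCommGroup B']
    [Module ℝ B'] (p : A ⊗[ℝ] B →ₗ[ℝ] C) (hp : Function.Surjective p)
    (q : A ⊗[ℝ] B →ₗ[ℝ] A' ⊗[ℝ] B') (h : ∀ t, p t = 0 → q t = 0) :
    ∃ g : C →ₗ[ℝ] A' ⊗[ℝ] B', ∀ t, g (p t) = q t :=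
  ⟨FilteredManifold.descend p hp q fun t ht => h t ht,
    FilteredManifold.descend_apply p hp q fun t ht => h t ht⟩

namespace FilteredManifold

variable {n : ℕ} {M : Type u} [TopologicalSpace M] [ChartedSpace (EuclideanSpace ℝ (Fin n)) M]
  [IsManifold (𝓡 n) ∞ M]

theorem exists_section (F : FilteredManifold n M) {i : ℕ} {x : M} {v : TangentSpace (𝓡 n) x}
    (hv : v ∈ F.T i x) : ∃ X, F.IsSection i x X ∧ X x = v := by
  obtain ⟨m, X, hX, h⟩ := F.subbundle i x
  have hv' := hv
  rw [← h.self_of_nhds.2, Submodule.mem_span_range_iff_exists_fun] at hv'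
  obtain ⟨c, hc⟩ := hv'
  refine ⟨fun y => ∑ a, c a • X a y, ⟨?_, ?_⟩, hc⟩
  · filter_upwards [eventually_all.2 hX] with y hy
    exact ContMDiffAt.sum_section fun a _ => (hy a).const_smul_section
  · filter_upwards [h] with y hy
    rw [← hy.2]
    exact Submodule.sum_mem _ fun a _ =>
      Submodule.smul_mem _ _ (Submodule.subset_span ⟨a, rfl⟩)

theorem finiteDimensional_grFiber (F : FilteredManifold n M) (i : ℕ) (x : M) :
    FiniteDimensional ℝ (F.GrFiber i x) := by
  have : FiniteDimensional ℝ (TangentSpace (𝓡 n) x) :=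
    inferInstanceAs (FiniteDimensional ℝ (EuclideanSpace ℝ (Fin n)))
  infer_instance

/-- The restriction of the differential `df(x)` to `gr₋₁(T_xM)`. -/
def grDiff (F : FilteredManifold n M) (x : M) (f : M → ℝ) : Module.Dual ℝ (F.GrFiber 1 x) :=
  Submodule.liftQ _ ((mvfderiv (𝓡 n) f x).toLinearMap ∘ₗ (F.T 1 x).subtype) (by
    intro X hX
    have h0 : (X : TangentSpace (𝓡 n) x) ∈ F.T 0 x := hX
    rw [F.zero x, Submodule.mem_bot] at h0
    simp [h0])

section Differential

variable (F : FilteredManifold n M) {x : M}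

theorem grDiff_ext {f : M → ℝ} {ψ : Module.Dual ℝ (F.GrFiber 1 x)}
    (h : ∀ X : ∀ y : M, TangentSpace (𝓡 n) y, ∀ hX : X x ∈ F.T 1 x,
      lieD X f x = ψ (Submodule.Quotient.mk ⟨X x, hX⟩)) : F.grDiff x f = ψ := by
  refine Submodule.linearMap_qext _ (LinearMap.ext fun v => ?_)
  obtain ⟨X, hX, hXv⟩ := F.exists_section v.2
  have h1 := h X (hXv ▸ v.2)
  have h2 : (⟨X x, hXv ▸ v.2⟩ : F.T 1 x) = v := Subtype.ext hXv
  rw [h2, lieD, hXv] at h1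
  exact h1

theorem grDiff_apply (f : M → ℝ) {X : ∀ y : M, TangentSpace (𝓡 n) y} (hX : X x ∈ F.T 1 x) :
    F.grDiff x f (Submodule.Quotient.mk ⟨X x, hX⟩) = lieD X f x := rfl

theorem grDiff_add {f g : M → ℝ} (hf : SmoothNear n x f) (hg : SmoothNear n x g) :
    F.grDiff x (f + g) = F.grDiff x f + F.grDiff x g :=
  F.grDiff_ext fun X _ => lieD_add X hf hg

theorem grDiff_mul {f g : M → ℝ} (hf : SmoothNear n x f) (hg : SmoothNear n x g) :
    F.grDiff x (f * g) = f x • F.grDiff x g + g x • F.grDiff x f :=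
  F.grDiff_ext fun X _ => lieD_mul X hf hg

theorem grDiff_const (c : ℝ) : F.grDiff x (fun _ => c) = 0 :=
  F.grDiff_ext fun X _ => lieD_const X c

theorem grDiff_smul (c : ℝ) {f : M → ℝ} (hf : SmoothNear n x f) :
    F.grDiff x (c • f) = c • F.grDiff x f := by
  have h := F.grDiff_mul (SmoothNear.const x c) hf
  rw [F.grDiff_const, smul_zero, add_zero] at h
  exact h

theorem dGr_eq_grDiff (f : vanishing n x) : F.dGr x f = F.grDiff x f.1 := rfl

theorem grDiff_sub_const {f : M → ℝ} (hf : SmoothNear n x f) (c : ℝ) :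
    F.grDiff x (fun y => f y - c) = F.grDiff x f := by
  have h := F.grDiff_add hf (SmoothNear.const x (-c))
  rw [F.grDiff_const, add_zero] at h
  have e : (fun y => f y - c) = f + fun _ => -c := by
    funext y
    simp [sub_eq_add_neg]
  rw [e, h]

theorem grDiff_mem_germs {f : M → ℝ} (hf : SmoothNear n x f) :
    (fun y => F.grDiff y f) ∈ (F.gr 1).dual.germs x := by
  change ∀ᶠ y in 𝓝 x, ∀ σ ∈ (F.gr 1).germs y, SmoothNear n y (fun z => F.grDiff z f (σ z))
  filter_upwards [hf.eventually] with y hy σ hσ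
  obtain ⟨X, hX, h⟩ := hσ
  refine (hy.lieD hX).congr (h.mono fun z hz => ?_)
  rw [hz]
  rfl

end Differential

/-! ### The Spencer operator -/

section Spencer

variable (F : FilteredManifold n M) (r : ℕ) (V : SmoothBundle.{u, v} n M) (x : M)

theorem smul_jetAt_mem_germs {f : M → ℝ} (hf : SmoothNear n x f) {s : ∀ y, V.Fiber y}
    (hs : s ∈ V.germs x) : (fun y => f y • F.jetAt r V y s) ∈ (F.jet r V).germs x :=
  (F.jet r V).smul' hf (F.jetAt_mem_germs r hs)

/-- The linear map `f ⊗ s ↦ j^1_x (f j^r s)`. -/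
def jetParam : smoothFunctions n x ⊗[ℝ] V.germs x →ₗ[ℝ] (F.jet 1 (F.jet r V)).Fiber x :=
  TensorProduct.lift (LinearMap.mk₂ ℝ
    (fun f s => F.jetAt 1 (F.jet r V) x (fun y => f.1 y • F.jetAt r V y s.1))
    (fun f g s => by
      rw [← F.jetAt_add (F.smul_jetAt_mem_germs r V x f.2 s.2)
        (F.smul_jetAt_mem_germs r V x g.2 s.2)]
      congr 1
      funext y
      simp [add_smul])
    (fun c f s => by
      rw [← F.jetAt_smul c (F.smul_jetAt_mem_germs r V x f.2 s.2)]
      congr 1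
      funext y
      simp [mul_smul])
    (fun f s t => by
      rw [← F.jetAt_add (F.smul_jetAt_mem_germs r V x f.2 s.2)
        (F.smul_jetAt_mem_germs r V x f.2 t.2)]
      -- `jetAt` is 0 by default where a section is not smooth, so additivity in s is available only
      -- near x; a germ is enough.
      refine F.jetAt_congr (F.smul_jetAt_mem_germs r V x f.2 (s + t).2) ?_
      filter_upwards [V.eventually' s.2, V.eventually' t.2] with y h1 h2
      change f.1 y • F.jetAt r V y (s.1 + t.1) = _
      rw [F.jetAt_add h1 h2, smul_add]
      rfl)
    (fun c f s => by
      rw [← F.jetAt_smul c (F.smul_jetAt_mem_germs r V x f.2 s.2)]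
      refine F.jetAt_congr (F.smul_jetAt_mem_germs r V x f.2 (c • s).2) ?_
      filter_upwards [V.eventually' s.2] with y h1
      change f.1 y • F.jetAt r V y (c • s.1) = _
      rw [F.jetAt_smul c h1, smul_comm]
      rfl))

theorem jetParam_tmul (f : smoothFunctions n x) (s : V.germs x) :
    F.jetParam r V x (f ⊗ₜ s) =
      F.jetAt 1 (F.jet r V) x (fun y => f.1 y • F.jetAt r V y s.1) := rfl

/-- The linear map `f ⊗ s ↦ df(x) ⊗ j^{r-1}_x s`. -/
def spencerParam : smoothFunctions n x ⊗[ℝ] V.germs x →ₗ[ℝ]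
    Module.Dual ℝ (F.GrFiber 1 x) ⊗[ℝ] F.JetFiber (r - 1) V x :=
  TensorProduct.map
    { toFun := fun f => F.grDiff x f.1
      map_add' := fun f g => F.grDiff_add f.2 g.2
      map_smul' := fun c f => F.grDiff_smul c f.2 }
    (F.jetZero (r - 1) V x).mkQ

theorem spencerParam_tmul (f : smoothFunctions n x) (s : V.germs x) :
    F.spencerParam r V x (f ⊗ₜ s) = F.grDiff x f.1 ⊗ₜ F.jetAt (r - 1) V x s.1 := by
  rw [jetAt_of_mem s.2]
  rfl

variable {r V x}

theorem jetAt_eq_jetParam {σ : ∀ y, (F.jet r V).Fiber y} {m : ℕ}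
    (f : Fin m → smoothFunctions n x) (s : Fin m → V.germs x)
    (hσ : ∀ᶠ y in 𝓝 x, σ y = ∑ i, (f i).1 y • F.jetAt r V y (s i).1) :
    F.jetAt 1 (F.jet r V) x σ = F.jetParam r V x (∑ i, f i ⊗ₜ s i) := by
  have h1 : ∀ i, (fun y => (f i).1 y • F.jetAt r V y (s i).1) ∈ (F.jet r V).germs x :=
    fun i => F.smul_jetAt_mem_germs r V x (f i).2 (s i).2
  refine Eq.trans ?_ (((map_sum (F.jetParam r V x) _ _).trans
    (Finset.sum_congr rfl fun i _ => F.jetParam_tmul r V x (f i) (s i))).symm)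
  refine Eq.trans ?_ (F.jetAt_sum h1)
  refine (F.jetAt_congr (sum_mem fun i _ => h1 i) (hσ.mono fun y hy => ?_)).symm
  rw [hy, Finset.sum_apply]

theorem exists_jetAt_eq (W : SmoothBundle.{u, v} n M) (j : F.JetFiber r W x) :
    ∃ σ ∈ W.germs x, F.jetAt r W x σ = j := by
  obtain ⟨σ, rfl⟩ := Submodule.Quotient.mk_surjective _ j
  exact ⟨σ.1, σ.2, jetAt_of_mem σ.2⟩

/-- By the choice of smooth structure, every local section of J^r(V) is a finite sum ∑ fᵢ j^r sᵢ
near x. -/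
theorem jetParam_surjective : Function.Surjective (F.jetParam r V x) := by
  intro j
  obtain ⟨σ, hσ, hj⟩ := F.exists_jetAt_eq (F.jet r V) j
  obtain ⟨m, f, s, hf, hs, h⟩ := F.exists_jet_sum hσ
  exact ⟨_, (F.jetAt_eq_jetParam (fun i => ⟨f i, hf i⟩) (fun i => ⟨s i, hs i⟩) h).symm.trans hj⟩

/-- The coefficients X · fᵢ are frozen at x, so the contraction with X(x) is the jet of a section
with constant coefficients, and the word criterion decides whether it vanishes. -/
theorem dualTensorHom_sum_mk {m : ℕ} {f : Fin m → M → ℝ} {s : Fin m → ∀ y, V.Fiber y}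
    (hs : ∀ i, s i ∈ V.germs x) {X : ∀ y : M, TangentSpace (𝓡 n) y} (hX : X x ∈ F.T 1 x) (q : ℕ) :
    dualTensorHom ℝ (F.GrFiber 1 x) (F.JetFiber q V x)
      (∑ i, F.grDiff x (f i) ⊗ₜ F.jetAt q V x (s i)) (Submodule.Quotient.mk ⟨X x, hX⟩) =
      F.jetAt q V x (∑ i, lieD X (f i) x • s i) := by
  rw [F.jetAt_sum fun i => Submodule.smul_mem _ _ (hs i), map_sum, LinearMap.sum_apply]
  refine Finset.sum_congr rfl fun i _ => ?_
  rw [dualTensorHom_apply, F.grDiff_apply, F.jetAt_smul _ (hs i)]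

theorem iterD_sum_smul {q : ℕ} {L : List (ℕ × (∀ y : M, TangentSpace (𝓡 n) y))}
    (hL : F.IsWord q x L) {φ : ∀ y, Module.Dual ℝ (V.Fiber y)} (hφ : φ ∈ V.dual.germs x)
    {m : ℕ} (c : Fin m → ℝ) {s : Fin m → ∀ y, V.Fiber y} (hs : ∀ i, s i ∈ V.germs x) :
    iterD (L.map Prod.snd) (fun y => φ y ((∑ i, c i • s i) y)) x =
      ∑ i, c i * iterD (L.map Prod.snd) (fun y => φ y (s i y)) x := by
  have h : ∀ i, c i • s i ∈ V.germs x := fun i => Submodule.smul_mem _ _ (hs i)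
  rw [← F.wordForm_jetAt hL hφ (sum_mem fun i _ => h i), F.jetAt_sum h, map_sum]
  refine Finset.sum_congr rfl fun i _ => ?_
  rw [F.jetAt_smul _ (hs i), map_smul, F.wordForm_jetAt hL hφ (hs i), smul_eq_mul]

/-- Well-definedness of the operator. The tensor is contracted with a vector of T⁻¹M, extended to a
local section X, and the resulting (r-1)-jet is tested by words; what remains is
`sum_lieD_word_eq_zero`. -/
theorem spencerParam_eq_zero (hr : 1 ≤ r) (t : smoothFunctions n x ⊗[ℝ] V.germs x)
    (ht : F.jetParam r V x t = 0) : F.spencerParam r V x t = 0 := by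
  obtain ⟨m, f, s, rfl⟩ := exists_fin_sum_tmul t
  have hσ := F.jetAt_eq_jetParam (r := r) (V := V) (x := x) f s
    (Eventually.of_forall fun y => rfl)
  have hmem : (fun y => ∑ i, (f i).1 y • F.jetAt r V y (s i).1) ∈ (F.jet r V).germs x := by
    have h1 : (∑ i, fun y => (f i).1 y • F.jetAt r V y (s i).1) ∈ (F.jet r V).germs x :=
      sum_mem fun i _ => F.smul_jetAt_mem_germs r V x (f i).2 (s i).2
    refine (F.jet r V).congr' h1 (Eventually.of_forall fun y => ?_)
    rw [Finset.sum_apply]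
  have h0 := hσ.trans ht
  rw [map_sum]
  simp only [spencerParam_tmul]
  have := F.finiteDimensional_grFiber 1 x
  refine dual_tensor_eq_zero fun a => ?_
  obtain ⟨v, rfl⟩ := Submodule.Quotient.mk_surjective _ a
  obtain ⟨X, hX, hXv⟩ := F.exists_section v.2
  have hv : v = ⟨X x, hXv ▸ v.2⟩ := Subtype.ext hXv.symm
  rw [hv, F.dualTensorHom_sum_mk (fun i => (s i).2) (hXv ▸ v.2), F.jetAt_eq_zero_iff
    (sum_mem fun i _ => Submodule.smul_mem _ _ (s i).2)]
  intro L hL φ hφ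
  rw [F.iterD_sum_smul hL hφ _ fun i => (s i).2]
  exact F.sum_lieD_word_eq_zero (fun i => (f i).2) (fun i => (s i).2)
    (Eventually.of_forall fun y => rfl) hmem h0 hX (q := r - 1) (by omega) hL hφ

/-- The Spencer operator at a point. -/
def spencerApp (hr : 1 ≤ r) (V : SmoothBundle.{u, v} n M) (x : M) :
    (F.jet 1 (F.jet r V)).Fiber x →ₗ[ℝ]
      Module.Dual ℝ (F.GrFiber 1 x) ⊗[ℝ] F.JetFiber (r - 1) V x :=
  Classical.choose (exists_descend_tensor (F.jetParam r V x) (F.jetParam_surjective)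
    (F.spencerParam r V x) (F.spencerParam_eq_zero hr))

theorem spencerApp_jetParam (hr : 1 ≤ r) (t : smoothFunctions n x ⊗[ℝ] V.germs x) :
    F.spencerApp hr V x (F.jetParam r V x t) = F.spencerParam r V x t :=
  Classical.choose_spec (exists_descend_tensor (F.jetParam r V x) (F.jetParam_surjective)
    (F.spencerParam r V x) (F.spencerParam_eq_zero hr)) t

theorem spencerApp_jetAt (hr : 1 ≤ r) {σ : ∀ y, (F.jet r V).Fiber y} {m : ℕ} {f : Fin m → M → ℝ}
    {s : Fin m → ∀ y, V.Fiber y} (hf : ∀ i, SmoothNear n x (f i)) (hs : ∀ i, s i ∈ V.germs x)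
    (hσ : ∀ᶠ y in 𝓝 x, σ y = ∑ i, f i y • F.jetAt r V y (s i)) :
    F.spencerApp hr V x (F.jetAt 1 (F.jet r V) x σ) =
      ∑ i, F.grDiff x (f i) ⊗ₜ F.jetAt (r - 1) V x (s i) := by
  rw [F.jetAt_eq_jetParam (fun i => ⟨f i, hf i⟩) (fun i => ⟨s i, hs i⟩) hσ, spencerApp_jetParam, map_sum]
  simp only [spencerParam_tmul]

/-- The input is locally ∑ gₐ j^1 σₐ with σₐ = ∑ fᵢ j^r sᵢ. The explicit formula holds at all nearby
points and turns j^1 σₐ into ∑ dfᵢ ⊗ j^{r-1} sᵢ, a sum of generating sections of the target. -/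
theorem spencerApp_smooth (hr : 1 ≤ r) {τ : ∀ y, (F.jet 1 (F.jet r V)).Fiber y}
    (hτ : τ ∈ (F.jet 1 (F.jet r V)).germs x) :
    (fun y => F.spencerApp hr V y (τ y)) ∈ (F.spencerTarget (r - 1) V).germs x := by
  obtain ⟨k, g, σ, hg, hσ, h⟩ := F.exists_jet_sum hτ
  have h1 : ∀ a, (fun y => F.spencerApp hr V y (F.jetAt 1 (F.jet r V) y (σ a))) ∈
      (F.spencerTarget (r - 1) V).germs x := fun a => by
    obtain ⟨m, f, s, hf, hs, h2⟩ := F.exists_jet_sum (hσ a)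
    refine ⟨m, fun _ _ => 1, fun i y => F.grDiff y (f i) ⊗ₜ F.jetAt (r - 1) V y (s i),
      fun _ => SmoothNear.const x 1, fun i => ⟨_, F.grDiff_mem_germs (hf i), _,
        F.jetAt_mem_germs (r - 1) (hs i), rfl⟩, ?_⟩
    filter_upwards [eventually_all.2 fun i => (hf i).eventually,
      eventually_all.2 fun i => V.eventually' (hs i), eventually_eventually_nhds.2 h2]
      with y h3 h4 h5
    simp only [one_smul]
    exact F.spencerApp_jetAt hr h3 h4 h5
  have h2 : (∑ a, fun y => g a y • F.spencerApp hr V y (F.jetAt 1 (F.jet r V) y (σ a))) ∈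
      (F.spencerTarget (r - 1) V).germs x :=
    sum_mem fun a _ => (F.spencerTarget (r - 1) V).smul' (hg a) (h1 a)
  refine (F.spencerTarget (r - 1) V).congr' h2 (h.mono fun y hy => ?_)
  rw [hy, map_sum, Finset.sum_apply]
  simp only [map_smul]

/-- The weighted Spencer operator `J^1(J^r(V)) → gr₋₁(TM)^* ⊗ J^{r-1}(V)`. -/
def spencer (hr : 1 ≤ r) (V : SmoothBundle.{u, v} n M) :
    (F.jet 1 (F.jet r V)).Hom (F.spencerTarget (r - 1) V) where
  app := F.spencerApp hr V
  smooth := fun _ _ hτ => F.spencerApp_smooth hr hτ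

/-- Both properties are one-term cases of the formula: f = 1, with zero differential, for holonomic
jets, and f vanishing at x for the symbol. -/
theorem isSpencerOperator_spencer (hr : 1 ≤ r) (V : SmoothBundle.{u, v} n M) :
    F.IsSpencerOperator r V (F.spencer hr V) := by
  refine ⟨?_, fun x => ?_⟩
  · rintro x _ ⟨s, hs, rfl⟩
    have h := F.spencerApp_jetAt hr (r := r) (V := V) (x := x)
      (σ := fun y => F.jetAt r V y s) (f := fun _ : Fin 1 => fun _ => 1) (s := fun _ => s)
      (fun _ => SmoothNear.const x 1) (fun _ => hs) (Eventually.of_forall fun y => by simp)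
    refine h.trans ?_
    simp [F.grDiff_const]
  · refine TensorProduct.ext' fun ψ j => ?_
    obtain ⟨f, rfl⟩ := F.dGr_surjective x ψ
    obtain ⟨s, rfl⟩ := Submodule.Quotient.mk_surjective _ j
    have hf : SmoothNear n x f.1 := f.2.1
    rw [TensorProduct.map_tmul, ← jetAt_of_mem s.2, F.jetProj_jetAt _ s.2]
    change F.spencerApp hr V x (F.symbolInclusion _ _ x _) = _
    rw [F.symbolInclusion_apply (F.jet r V) (F.jet_spanned r V) x f (F.jetAt_mem_germs r s.2),
      F.spencerApp_jetAt hr (f := fun _ : Fin 1 => f.1) (s := fun _ => s.1) (fun _ => hf)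
        (fun _ => s.2) (Eventually.of_forall fun y => by simp)]
    simp [dGr_eq_grDiff]

/-- Every operator with the properties of the Spencer operator is given by
`j^1_x (∑ fᵢ j^r sᵢ) ↦ ∑ dfᵢ(x) ⊗ j^{r-1}_x sᵢ`. -/
theorem IsSpencerOperator.app_jetAt {F : FilteredManifold n M}
    {S : (F.jet 1 (F.jet r V)).Hom (F.spencerTarget (r - 1) V)} (hS : F.IsSpencerOperator r V S)
    {σ : ∀ y, (F.jet r V).Fiber y} {m : ℕ} {f : Fin m → M → ℝ}
    {s : Fin m → ∀ y, V.Fiber y} (hf : ∀ i, SmoothNear n x (f i)) (hs : ∀ i, s i ∈ V.germs x)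
    (hσ : ∀ᶠ y in 𝓝 x, σ y = ∑ i, f i y • F.jetAt r V y (s i)) :
    S.app x (F.jetAt 1 (F.jet r V) x σ) =
      ∑ i, F.grDiff x (f i) ⊗ₜ F.jetAt (r - 1) V x (s i) := by
  rw [F.jetAt_eq_jetParam (fun i => ⟨f i, hf i⟩) (fun i => ⟨s i, hs i⟩) hσ, map_sum, map_sum]
  refine Finset.sum_congr rfl fun i _ => ?_
  -- Splitting fᵢ = fᵢ(x) + g: the constant part gives a multiple of a holonomic jet, which S kills,
  -- and the g part lies in the image of the symbol inclusion, where S is prescribed.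
  let g : vanishing n x := ⟨fun y => f i y - f i x, smoothNear_sub_const (hf i) _, sub_self _⟩
  have h1 := F.jetAt_mem_germs r (hs i)
  have h2 : F.jetAt 1 (F.jet r V) x (fun y => f i y • F.jetAt r V y (s i)) =
      f i x • F.jetAt 1 (F.jet r V) x (fun y => F.jetAt r V y (s i)) +
      F.symbolInclusion (F.jet r V) (F.jet_spanned r V) x
        (F.dGr x g ⊗ₜ F.jetAt r V x (s i)) := by
    have h3 := F.symbolInclusion_apply (F.jet r V) (F.jet_spanned r V) x g h1
    rw [h3, ← F.jetAt_smul _ h1, ← F.jetAt_add (Submodule.smul_mem _ _ h1)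
      ((F.jet r V).smul' g.2.1 h1)]
    congr 1
    funext y
    simp [g, sub_smul]
  rw [jetParam_tmul, h2, map_add, map_smul, hS.1 x _ ⟨s i, hs i, rfl⟩, smul_zero, zero_add]
  refine (LinearMap.congr_fun (hS.2 x) _).trans ?_
  rw [TensorProduct.map_tmul, F.jetProj_jetAt _ (hs i), dGr_eq_grDiff, F.grDiff_sub_const (hf i)]
  rfl

theorem existsUnique_isSpencerOperator (hr : 1 ≤ r) (V : SmoothBundle.{u, v} n M) :
    ∃! S, F.IsSpencerOperator r V S := by
  refine ⟨F.spencer hr V, F.isSpencerOperator_spencer hr V, fun S hS => ?_⟩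
  refine SmoothBundle.Hom.ext (funext fun x => LinearMap.ext fun j => ?_)
  obtain ⟨σ, hσ, rfl⟩ := F.exists_jetAt_eq (F.jet r V) j
  obtain ⟨m, f, s, hf, hs, h⟩ := F.exists_jet_sum hσ
  rw [hS.app_jetAt hf hs h,
    (F.isSpencerOperator_spencer hr V).app_jetAt hf hs h]

end Spencer

end FilteredManifold
end
end WeightedJet

namespace WeightedJet

universe u v w

noncomputable section

/-! ### Exactness: sections killed by the Spencer operator are holonomic -/

section Functions

variable {n : ℕ} {M : Type u} [TopologicalSpace M] [ChartedSpace (EuclideanSpace ℝ (Fin n)) M]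

theorem lieD_sum_mul {x : M} {m : ℕ} {f g : Fin m → M → ℝ} (X : ∀ y : M, TangentSpace (𝓡 n) y)
    (hf : ∀ i, SmoothNear n x (f i)) (hg : ∀ i, SmoothNear n x (g i)) :
    lieD X (fun y => ∑ i, f i y * g i y) x =
      ∑ i, f i x * lieD X (g i) x + ∑ i, lieD X (f i) x * g i x := by
  rw [lieD_sum X fun i => (hf i).mul (hg i), ← Finset.sum_add_distrib]
  refine Finset.sum_congr rfl fun i _ => ?_
  rw [lieD_mul X (hf i) (hg i), mul_comm (g i x)]

theorem sum_smul_mem_germs {V : SmoothBundle.{u, v} n M} {x : M} {m : ℕ} {f : Fin m → M → ℝ}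
    {s : Fin m → ∀ y, V.Fiber y} (hf : ∀ k, SmoothNear n x (f k)) (hs : ∀ k, s k ∈ V.germs x) :
    (fun y => ∑ k, f k y • s k y) ∈ V.germs x := by
  have h : (∑ k, fun y => f k y • s k y) ∈ V.germs x :=
    sum_mem fun k _ => V.smul' (hf k) (hs k)
  refine V.congr' h (Eventually.of_forall fun y => ?_)
  rw [Finset.sum_apply]

end Functions

namespace FilteredManifold

variable {n : ℕ} {M : Type u} [TopologicalSpace M] [ChartedSpace (EuclideanSpace ℝ (Fin n)) M]
  [IsManifold (𝓡 n) ∞ M]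

/-- Sections of T⁰M vanish near x. This settles brackets of weights 0 and i in the generation
argument, where induction on the weight gives nothing. -/
theorem IsSection.mlieBracket_eq_zero_left {F : FilteredManifold n M} {x : M}
    {X : ∀ y : M, TangentSpace (𝓡 n) y} (hX : F.IsSection 0 x X)
    (Y : ∀ y : M, TangentSpace (𝓡 n) y) : VectorField.mlieBracket (𝓡 n) X Y x = 0 := by
  have h : X =ᶠ[𝓝 x] (0 : ∀ y : M, TangentSpace (𝓡 n) y) := hX.2.mono fun y hy => by
    rw [F.zero y, Submodule.mem_bot] at hy
    exact hy
  exact (h.mlieBracket_vectorField_eq (EventuallyEq.refl _ Y)).trans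
    (congrFun VectorField.mlieBracket_zero_left x)

theorem IsSection.mlieBracket_eq_zero_right {F : FilteredManifold n M} {x : M}
    (X : ∀ y : M, TangentSpace (𝓡 n) y) {Y : ∀ y : M, TangentSpace (𝓡 n) y}
    (hY : F.IsSection 0 x Y) : VectorField.mlieBracket (𝓡 n) X Y x = 0 := by
  rw [VectorField.mlieBracket_swap_apply, hY.mlieBracket_eq_zero_left, neg_zero]

section Exactness

variable (F : FilteredManifold n M) (r : ℕ) (V : SmoothBundle.{u, v} n M) {m : ℕ}
  (f : Fin m → M → ℝ) (s : Fin m → ∀ y, V.Fiber y)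

/-- The vectors `v` in `T⁻ⁱ_xM` with `∑ (v · fₖ) j^{r-i}_x sₖ = 0`. -/
def spencerKernel (i : ℕ) (x : M) : Submodule ℝ (TangentSpace (𝓡 n) x) where
  -- The bound i + w ≤ r makes the condition empty for i > r; truncated subtraction in w ≤ r - i
  -- would still impose it on the empty word.
  carrier := {v | v ∈ F.T i x ∧ ∀ w, i + w ≤ r → ∀ L, F.IsWord w x L → ∀ φ ∈ V.dual.germs x,
    ∑ k, mvfderiv (𝓡 n) (f k) x v * iterD (L.map Prod.snd) (fun z => φ z (s k z)) x = 0}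
  add_mem' := fun {a b} ha hb => ⟨add_mem ha.1 hb.1, fun w hw L hL φ hφ => by
    simp only [map_add, add_mul, Finset.sum_add_distrib]
    rw [ha.2 w hw L hL φ hφ, hb.2 w hw L hL φ hφ, add_zero]⟩
  zero_mem' := ⟨zero_mem _, fun w hw L hL φ hφ => by simp⟩
  smul_mem' := fun c a ha => ⟨Submodule.smul_mem _ c ha.1, fun w hw L hL φ hφ => by
    simp only [map_smul, smul_eq_mul, mul_assoc]
    rw [← Finset.mul_sum, ha.2 w hw L hL φ hφ, mul_zero]⟩

/-- The data `fₖ`, `sₖ` are smooth near `x` and the Spencer operator kills `∑ fₖ j^r sₖ` at `x`. -/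
def SpencerClosedAt (x : M) : Prop :=
  (∀ k, SmoothNear n x (f k)) ∧ (∀ k, s k ∈ V.germs x) ∧ F.T 1 x ≤ F.spencerKernel r V f s 1 x

variable {F r V f s}

theorem lieD_sum_word_eq_zero {i w : ℕ} {x : M} (h : F.T i x ≤ F.spencerKernel r V f s i x)
    {X : ∀ y : M, TangentSpace (𝓡 n) y} (hX : X x ∈ F.T i x) (hw : i + w ≤ r)
    {L : List (ℕ × (∀ y : M, TangentSpace (𝓡 n) y))} (hL : F.IsWord w x L)
    {φ : ∀ y, Module.Dual ℝ (V.Fiber y)} (hφ : φ ∈ V.dual.germs x) :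
    ∑ k, lieD X (f k) x * iterD (L.map Prod.snd) (fun z => φ z (s k z)) x = 0 :=
  (h hX).2 w hw L hL φ hφ

/-- Differentiate ∑ (Y fₖ) L⟨φ, sₖ⟩ = 0 along X. The unwanted half ∑ (Y fₖ) X L⟨φ, sₖ⟩ is the same
relation for the word X L of weight a + w, admissible because b + (a + w) ≤ r. -/
theorem sum_lieD_lieD_mul_word {a b w : ℕ} {x : M} (ha : 1 ≤ a)
    (hc : ∀ᶠ y in 𝓝 x, F.SpencerClosedAt r V f s y)
    (hT : ∀ᶠ y in 𝓝 x, F.T b y ≤ F.spencerKernel r V f s b y)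
    {X Y : ∀ y : M, TangentSpace (𝓡 n) y} (hX : F.IsSection a x X) (hY : F.IsSection b x Y)
    (hw : a + b + w ≤ r) {L : List (ℕ × (∀ y : M, TangentSpace (𝓡 n) y))} (hL : F.IsWord w x L)
    {φ : ∀ y, Module.Dual ℝ (V.Fiber y)} (hφ : φ ∈ V.dual.germs x) :
    ∑ k, lieD X (lieD Y (f k)) x * iterD (L.map Prod.snd) (fun z => φ z (s k z)) x = 0 := by
  have hc0 := hc.self_of_nhds
  have h1 : ∀ᶠ y in 𝓝 x,
      ∑ k, lieD Y (f k) y * iterD (L.map Prod.snd) (fun z => φ z (s k z)) y = 0 := by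
    filter_upwards [hT, hY.2, hL.eventually, V.dual.eventually' hφ] with y h2 h3 h4 h5
    exact lieD_sum_word_eq_zero h2 h3 (by omega) h4 h5
  have h2 := lieD_eq_zero X h1
  rw [lieD_sum_mul X (fun k => (hc0.1 k).lieD hY.1)
    (fun k => F.smoothNear_word hL hφ (hc0.2.1 k))] at h2
  have h3 := lieD_sum_word_eq_zero hT.self_of_nhds hY.2.self_of_nhds (w := a + w) (by omega)
    (hL.cons ha hX) hφ
  change ∑ k, lieD Y (f k) x * lieD X (iterD (L.map Prod.snd) (fun z => φ z (s k z))) x = 0 at h3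
  rwa [h3, zero_add] at h2

/-- Only weight one is assumed; the higher weights come from brackets, because gr₋₁ generates. The
induction runs over all points at once, since the relations of lower weight are differentiated. -/
theorem T_le_spencerKernel (hgen : F.GeneratedInDegreeOne) (i : ℕ) (x : M)
    (hc : ∀ᶠ y in 𝓝 x, F.SpencerClosedAt r V f s y) :
    F.T i x ≤ F.spencerKernel r V f s i x := by
  induction i using Nat.strong_induction_on generalizing x with
  | _ i ih =>
  have hc0 := hc.self_of_nhds
  have hc' : ∀ᶠ y in 𝓝 x, ∀ᶠ z in 𝓝 y, F.SpencerClosedAt r V f s z :=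
    eventually_eventually_nhds.2 hc
  rcases Nat.lt_or_ge i 2 with hi | hi
  · interval_cases i
    · rw [F.zero x]
      exact bot_le
    · exact hc0.2.2
  have hK : F.spencerKernel r V f s i x ≤ F.T i x := fun v hv => hv.1
  -- The graded subspace is shrunk in degree i only, so closure under the bracket needs proof only
  -- for weights adding up to i.
  have h := hgen x (fun j => if j = i then F.spencerKernel r V f s i x else F.T j x) ?_ ?_ ?_ i
  · rw [if_pos rfl] at h
    exact h.ge
  · intro j
    by_cases hj : j = i
    · subst hj
      simp only [if_pos]
      refine ⟨fun v hv => ?_, hK⟩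
      -- A vector of weight j - 1 satisfies the relations for all words with j - 1 + w ≤ r, which
      -- include those required in weight j.
      have h1 := ih (j - 1) (by omega) x hc hv
      exact ⟨F.mono x (Nat.sub_le j 1) hv, fun w hw => h1.2 w (by omega)⟩
    · simp only [if_neg hj]
      exact ⟨F.mono x (Nat.sub_le j 1), le_rfl⟩
  · rw [if_neg (by omega)]
  · intro a b X Y hX hY _ _
    have hT := F.bracket a b x X Y hX.1 hX.2 hY.1 hY.2
    by_cases hab : a + b = i
    · rw [if_pos hab]
      rcases Nat.eq_zero_or_pos a with rfl | ha
      · rw [hX.mlieBracket_eq_zero_left]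
        exact zero_mem _
      rcases Nat.eq_zero_or_pos b with rfl | hb
      · rw [hY.mlieBracket_eq_zero_right]
        exact zero_mem _
      rw [hab] at hT
      refine ⟨hT, fun w hw L hL φ hφ => ?_⟩
      -- Both weights are now positive, hence less than i, and the induction hypothesis applies to Y
      -- and to X on a neighbourhood of x.
      have hXY := sum_lieD_lieD_mul_word ha hc
        (hc'.mono fun y hy => ih b (by omega) y hy) hX hY (by omega) hL hφ
      have hYX := sum_lieD_lieD_mul_word hb hc
        (hc'.mono fun y hy => ih a (by omega) y hy) hY hX (by omega) hL hφ
      have h1 : ∀ k, mvfderiv (𝓡 n) (f k) x (VectorField.mlieBracket (𝓡 n) X Y x) =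
          lieD X (lieD Y (f k)) x - lieD Y (lieD X (f k)) x :=
        fun k => lieD_mlieBracket (hc0.1 k) hX.1 hY.1
      simp only [h1, sub_mul, Finset.sum_sub_distrib]
      rw [hXY, hYX, sub_zero]
    · rwa [if_neg hab]

/-- Induction on the word. When its first field ξ is applied, the Leibniz terms ∑ (ξ fₖ) L⟨φ, sₖ⟩
vanish by `T_le_spencerKernel`, since the weights of ξ and L add up to at most r. -/
theorem sum_mul_word_eq (hgen : F.GeneratedInDegreeOne) {x : M}
    (hc : ∀ᶠ y in 𝓝 x, F.SpencerClosedAt r V f s y)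
    {L : List (ℕ × (∀ y : M, TangentSpace (𝓡 n) y))} (hL : F.IsWord r x L)
    {φ : ∀ y, Module.Dual ℝ (V.Fiber y)} (hφ : φ ∈ V.dual.germs x) :
    ∀ᶠ y in 𝓝 x, ∑ k, f k y * iterD (L.map Prod.snd) (fun z => φ z (s k z)) y =
      iterD (L.map Prod.snd) (fun z => φ z (∑ k, f k z • s k z)) y := by
  induction L with
  | nil => exact Eventually.of_forall fun y => by simp [iterD]
  | cons p L ih =>
    have hsum : p.1 + (L.map Prod.fst).sum ≤ r := by simpa using hL.2
    -- The tail is given its exact weight, since the bound r would leave no room for the first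
    -- field.
    have hLw : F.IsWord (L.map Prod.fst).sum x L := ⟨fun q hq => hL.1 q (by simp [hq]), le_rfl⟩
    have hLr : F.IsWord r x L := hLw.mono (by omega)
    have hp := hL.1 p (by simp)
    filter_upwards [lieD_congr p.2 (ih hLr), eventually_eventually_nhds.2 hc, hp.2.2,
      hLw.eventually, V.dual.eventually' hφ] with y h1 h2 h3 h4 h5
    have h6 := h2.self_of_nhds
    rw [lieD_sum_mul p.2 h6.1 (fun k => F.smoothNear_word h4 h5 (h6.2.1 k)),
      lieD_sum_word_eq_zero (T_le_spencerKernel hgen p.1 y h2) h3 hsum h4 h5, add_zero] at h1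
    exact h1

theorem jet_ext {x : M} {j j' : F.JetFiber r V x}
    (h : ∀ L, F.IsWord r x L → ∀ φ ∈ V.dual.germs x,
      F.wordForm r V L φ x j = F.wordForm r V L φ x j') : j = j' := by
  obtain ⟨σ, hσ, rfl⟩ := F.exists_jetAt_eq V j
  obtain ⟨τ, hτ, rfl⟩ := F.exists_jetAt_eq V j'
  rw [← sub_eq_zero, ← F.jetAt_sub hσ hτ, F.jetAt_eq_zero_iff (sub_mem hσ hτ)]
  intro L hL φ hφ
  rw [← F.wordForm_jetAt hL hφ (sub_mem hσ hτ), F.jetAt_sub hσ hτ, map_sub, h L hL φ hφ, sub_self]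

/-- A section of `J^r(V)` that is killed by the Spencer operator is holonomic. -/
theorem eq_jetAt_of_spencerClosed (hgen : F.GeneratedInDegreeOne) {x : M}
    (hc : ∀ᶠ y in 𝓝 x, F.SpencerClosedAt r V f s y) :
    ∑ k, f k x • F.jetAt r V x (s k) = F.jetAt r V x (fun y => ∑ k, f k y • s k y) := by
  have hc0 := hc.self_of_nhds
  refine jet_ext fun L hL φ hφ => ?_
  rw [F.wordForm_jetAt hL hφ (sum_smul_mem_germs hc0.1 hc0.2.1),
    (F.wordForm_sum hL hφ f hc0.2.1 (Eventually.of_forall fun y => rfl)).self_of_nhds]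
  exact (sum_mul_word_eq hgen hc hL hφ).self_of_nhds

/-- Contracting S(j^1_x σ) = 0 with X(x) makes the (r-1)-jet of ∑ (X fₖ)(x) sₖ vanish; words with 1
+ w ≤ r have weight at most r - 1. -/
theorem IsSpencerOperator.spencerClosedAt
    {S : (F.jet 1 (F.jet r V)).Hom (F.spencerTarget (r - 1) V)} (hS : F.IsSpencerOperator r V S)
    {σ : ∀ y, (F.jet r V).Fiber y} {x : M} (hf : ∀ k, SmoothNear n x (f k))
    (hs : ∀ k, s k ∈ V.germs x)
    (hσ : ∀ᶠ y in 𝓝 x, σ y = ∑ k, f k y • F.jetAt r V y (s k))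
    (h0 : S.app x (F.jetAt 1 (F.jet r V) x σ) = 0) : F.SpencerClosedAt r V f s x := by
  refine ⟨hf, hs, fun v hv => ⟨hv, fun w hw L hL φ hφ => ?_⟩⟩
  obtain ⟨X, hX, rfl⟩ := F.exists_section hv
  have h1 := (hS.app_jetAt hf hs hσ).symm.trans h0
  have h2 := F.dualTensorHom_sum_mk (f := f) hs hv (r - 1)
  rw [h1, map_zero, LinearMap.zero_apply, eq_comm, F.jetAt_eq_zero_iff
    (sum_mem fun k _ => Submodule.smul_mem _ _ (hs k))] at h2
  have h3 := h2 L (hL.mono (by omega)) φ hφ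
  rw [F.iterD_sum_smul hL hφ _ hs] at h3
  exact h3

/-! ### The underlying section of a section of the jet bundle -/

/-- The empty word evaluates ⟨φ, s⟩ at x, and local dual sections are assumed to separate the
vectors of the fibre. -/
theorem jetZero_le_ker_evalAt
    (hV : ∀ (x : M) (v : V.Fiber x), (∀ φ ∈ V.dual.germs x, φ x v = 0) → v = 0) (x : M) :
    F.jetZero r V x ≤ LinearMap.ker (V.evalAt x) := fun _ ht =>
  hV x _ fun φ hφ => F.mem_jetZero_iff.1 ht [] (IsWord.nil F r x) φ hφ

/-- The projection `J^r_x(V) → V_x`. -/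
def jetValue (F : FilteredManifold n M) (r : ℕ)
    (hV : ∀ (x : M) (v : V.Fiber x), (∀ φ ∈ V.dual.germs x, φ x v = 0) → v = 0) (x : M) :
    F.JetFiber r V x →ₗ[ℝ] V.Fiber x :=
  Submodule.liftQ _ (V.evalAt x) (jetZero_le_ker_evalAt hV x)

variable (hV : ∀ (x : M) (v : V.Fiber x), (∀ φ ∈ V.dual.germs x, φ x v = 0) → v = 0)

theorem jetValue_jetAt {x : M} {t : ∀ y, V.Fiber y} (ht : t ∈ V.germs x) :
    F.jetValue r hV x (F.jetAt r V x t) = t x := by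
  rw [jetAt_of_mem ht]
  rfl

/-- The right-hand side does not involve the presentation of σ, so the local solutions ∑ fₖ sₖ agree
on overlaps. -/
theorem jetValue_sum {x : M} (hs : ∀ k, s k ∈ V.germs x) {σ : ∀ y, (F.jet r V).Fiber y}
    (hσ : ∀ᶠ y in 𝓝 x, σ y = ∑ k, f k y • F.jetAt r V y (s k)) :
    ∀ᶠ y in 𝓝 x, ∑ k, f k y • s k y = F.jetValue r hV y (σ y) := by
  filter_upwards [hσ, eventually_all.2 fun k => V.eventually' (hs k)] with y h1 h2
  rw [h1, map_sum]
  refine Finset.sum_congr rfl fun k _ => ?_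
  rw [map_smul, jetValue_jetAt hV (h2 k)]

theorem jetSections_injective
    (hV : ∀ (x : M) (v : V.Fiber x), (∀ φ ∈ V.dual.germs x, φ x v = 0) → v = 0)
    (U : Opens M) : Function.Injective (F.jetSections r V U) := by
  intro s t hst
  refine Subtype.ext (funext fun x => ?_)
  have h1 : F.jetAt r V x (V.extend s.1) = F.jetAt r V x (V.extend t.1) :=
    congrFun (congrArg Subtype.val hst) x
  have h2 := congrArg (F.jetValue r hV x) h1
  rwa [jetValue_jetAt hV (s.2 x x.2), jetValue_jetAt hV (t.2 x x.2),
    SmoothBundle.extend_apply _ _ x.2, SmoothBundle.extend_apply _ _ x.2] at h2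

theorem IsSpencerOperator.exact
    (hV : ∀ (x : M) (v : V.Fiber x), (∀ φ ∈ V.dual.germs x, φ x v = 0) → v = 0)
    (hgen : F.GeneratedInDegreeOne)
    {S : (F.jet 1 (F.jet r V)).Hom (F.spencerTarget (r - 1) V)} (hS : F.IsSpencerOperator r V S)
    (U : Opens M) : Function.Exact (F.jetSections r V U)
      (S.onSections U ∘ₗ F.jetSections 1 (F.jet r V) U) := by
  intro σ
  have happ : ∀ x : U, ((S.onSections U ∘ₗ F.jetSections 1 (F.jet r V) U) σ).1 x =
      S.app x (F.jetAt 1 (F.jet r V) x ((F.jet r V).extend σ.1)) := fun x => rfl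
  constructor
  · intro h
    have h0 : ∀ x ∈ U, S.app x (F.jetAt 1 (F.jet r V) x ((F.jet r V).extend σ.1)) = 0 :=
      fun x hx => (happ ⟨x, hx⟩).symm.trans (congrFun (congrArg Subtype.val h) ⟨x, hx⟩)
    -- The solution is defined on all of U as the projection of σ; smoothness and σ = j^r t are then
    -- local questions.
    let t : ∀ x : U, V.Fiber x := fun x => F.jetValue r hV x (σ.1 x)
    have key : ∀ x ∈ U, V.extend t ∈ V.germs x ∧
        (F.jet r V).extend σ.1 x = F.jetAt r V x (V.extend t) := fun x hx => by
      obtain ⟨m, f, s, hf, hs, hσ⟩ := F.exists_jet_sum (σ.2 x hx)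
      have hU := U.isOpen.mem_nhds hx
      have h1 : ∀ᶠ y in 𝓝 x, ∑ k, f k y • s k y = V.extend t y := by
        filter_upwards [jetValue_sum hV hs hσ, hU] with y h2 hy
        rw [h2, SmoothBundle.extend_apply _ _ hy, SmoothBundle.extend_apply _ _ hy]
      have h2 := sum_smul_mem_germs hf hs
      have h3 : ∀ᶠ y in 𝓝 x, F.SpencerClosedAt r V f s y := by
        filter_upwards [eventually_all.2 fun k => (hf k).eventually,
          eventually_all.2 fun k => V.eventually' (hs k), eventually_eventually_nhds.2 hσ, hU]
          with y h4 h5 h6 hy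
        exact hS.spencerClosedAt h4 h5 h6 (h0 y hy)
      refine ⟨V.congr' h2 h1, ?_⟩
      rw [← F.jetAt_congr h2 h1, hσ.self_of_nhds, eq_jetAt_of_spencerClosed hgen h3]
    refine ⟨⟨t, fun x hx => (key x hx).1⟩, Subtype.ext (funext fun x => ?_)⟩
    refine (key x x.2).2.symm.trans ?_
    rw [SmoothBundle.extend_apply _ _ x.2]
  · rintro ⟨t, rfl⟩
    refine Subtype.ext (funext fun x => ?_)
    -- The two extensions to M of the section j^r t need only agree on U, which suffices for 1-jets
    -- at points of U.
    have h1 : F.jetAt 1 (F.jet r V) x (fun y => F.jetAt r V y (V.extend t.1)) =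
        F.jetAt 1 (F.jet r V) x ((F.jet r V).extend (F.jetSections r V U t).1) := by
      refine F.jetAt_congr (F.jetAt_mem_germs r (t.2 x x.2)) ?_
      filter_upwards [U.isOpen.mem_nhds x.2] with y hy
      rw [SmoothBundle.extend_apply _ _ hy]
      rfl
    exact hS.1 x _ ⟨V.extend t.1, t.2 x x.2, h1.symm⟩

end Exactness

end FilteredManifold

/-- A nonzero vector has nonzero coordinates in a trivialisation, and some continuous functional
does not vanish on them. Its composition with the trivialisation is smooth over the base set, hence
a local dual section. -/
theorem eq_zero_of_forall_dual_germs {n : ℕ} {M : Type u} [TopologicalSpace M]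
    [ChartedSpace (EuclideanSpace ℝ (Fin n)) M]
    {F : Type w} [NormedAddCommGroup F] [NormedSpace ℝ F]
    {E : M → Type v} [TopologicalSpace (TotalSpace F E)] [∀ x, TopologicalSpace (E x)]
    [∀ x, AddCommGroup (E x)] [∀ x, Module ℝ (E x)] [FiberBundle F E] [VectorBundle ℝ F E]
    [ContMDiffVectorBundle ∞ F E (𝓡 n)] (x : M) (v : E x)
    (h : ∀ φ ∈ (ofVectorBundle n F E).dual.germs x, φ x v = 0) : v = 0 := by
  set e := trivializationAt F E x
  have hx : x ∈ e.baseSet := mem_baseSet_trivializationAt F E x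
  by_contra hv
  have h1 : e.continuousLinearMapAt ℝ x v ≠ 0 := fun h0 => hv <| by
    rw [← e.symmL_continuousLinearMapAt (R := ℝ) hx v, h0, map_zero]
  obtain ⟨l, hl⟩ := SeparatingDual.exists_ne_zero (R := ℝ) h1
  refine hl (h (fun z => l.toLinearMap ∘ₗ (e.continuousLinearMapAt ℝ z).toLinearMap) ?_)
  change ∀ᶠ y in 𝓝 x, ∀ σ ∈ (ofVectorBundle n F E).germs y,
    SmoothNear n y (fun z => l (e.continuousLinearMapAt ℝ z (σ z)))
  filter_upwards [e.open_baseSet.mem_nhds hx] with y hy σ hσ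
  have hσ' : ∀ᶠ z in 𝓝 y, ContMDiffAt (𝓡 n) ((𝓡 n).prod 𝓘(ℝ, F)) ∞
    (fun z => TotalSpace.mk' F z (σ z)) z := hσ
  filter_upwards [hσ', e.open_baseSet.mem_nhds hy] with z hz hze
  refine (l.contMDiff.contMDiffAt.comp z ((e.contMDiffAt_section_iff hze).1 hz)).congr_of_eventuallyEq ?_
  filter_upwards [e.open_baseSet.mem_nhds hze] with p hp
  rw [Trivialization.continuousLinearMapAt_apply, Trivialization.coe_linearMapAt_of_mem _ hp]
  rfl

end
end WeightedJet

theorem proposition2 {n : ℕ} {M : Type*} [TopologicalSpace M] [T2Space M]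
    [SecondCountableTopology M] [ChartedSpace (EuclideanSpace ℝ (Fin n)) M]
    [IsManifold (𝓡 n) ∞ M]
    {F : Type*} [NormedAddCommGroup F] [NormedSpace ℝ F] [FiniteDimensional ℝ F]
    {E : M → Type*} [TopologicalSpace (Bundle.TotalSpace F E)] [∀ x, TopologicalSpace (E x)]
    [∀ x, AddCommGroup (E x)] [∀ x, Module ℝ (E x)] [FiberBundle F E] [VectorBundle ℝ F E]
    [ContMDiffVectorBundle ∞ F E (𝓡 n)]
    (𝓕 : WeightedJet.FilteredManifold n M) (hgen : 𝓕.GeneratedInDegreeOne)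
    (r : ℕ) (hr : 1 ≤ r) :
    (∃! S, 𝓕.IsSpencerOperator r (WeightedJet.ofVectorBundle n F E) S) ∧
    ∀ S, 𝓕.IsSpencerOperator r (WeightedJet.ofVectorBundle n F E) S →
      ∀ U : TopologicalSpace.Opens M,
        Function.Injective (𝓕.jetSections r (WeightedJet.ofVectorBundle n F E) U) ∧
        Function.Exact (𝓕.jetSections r (WeightedJet.ofVectorBundle n F E) U)
          (S.onSections U ∘ₗ 𝓕.jetSections 1 (𝓕.jet r (WeightedJet.ofVectorBundle n F E)) U) := by
  have hV := fun (x : M) (v : E x) =>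
    WeightedJet.eq_zero_of_forall_dual_germs (n := n) (F := F) (E := E) x v
  exact ⟨𝓕.existsUnique_isSpencerOperator hr _, fun S hS U =>
    ⟨WeightedJet.FilteredManifold.jetSections_injective hV U, hS.exact hV hgen U⟩⟩
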